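/- Let $n\ge 1$ and let $S^1=\mathbb{R}/2\pi\mathbb{Z}$. On $S^1\times\mathbb{R}^{2n}$, with coordinates $(\theta,x_1,y_1,\dots,x_n,y_n)$, consider the contact form $\lambda_0=d\theta+\sum_{i=1}^n(x_i\,dy_i-y_i\,dx_i)$ and the contact structure $\xi_0=\ker\lambda_0$. Let $\mathcal{J}(S^1\times\mathbb{R}^{2n},\xi_0)$ be the set of smooth complex structures $J$ on $\xi_0$ for which $d\lambda_0(\cdot,J\cdot)$ is symmetric and positive definite on $\xi_0$. For a contact form $\lambda=e^{F}\lambda_0$ with Reeb vector field $X_\lambda$ (so $\lambda(X_\lambda)=1$, $d\lambda(X_\lambda,\cdot)=0$) and for $J\in\mathcal{J}(S^1\times\mathbb{R}^{2n},\xi_0)$, let $\tilde J$ be the almost complex structure on $\mathbb{R}\times(S^1\times\mathbb{R}^{2n})$ with $\tilde J\partial_a=X_\lambda$ and $\tilde J|_{\xi_0}=J$. A finite-energy plane for the data $(\lambda,J)$ is a smooth map $\tilde u=(a,u):\mathbb{C}\to\mathbb{R}\times(S^1\times\mathbb{R}^{2n})$ with $d\tilde u\circ i=\tilde J\circ d\tilde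 u$ and $E(u)=\sup_{\varphi}\int_{\mathbb{C}}d(\varphi(a)\,u^*\lambda)<\infty$, where the supremum is over the smooth functions $\varphi:\mathbb{R}\to[0,1]$ with $\varphi'\ge 0$, $\varphi(-\infty)=0$ and $\varphi(+\infty)=1$. Its limit set is the union of the images of all periodic orbits $\gamma:\mathbb{R}/\mathbb{Z}\to S^1\times\mathbb{R}^{2n}$ of $X_\lambda$ ($\dot\gamma=T\,X_\lambda(\gamma)$ for some $T>0$) that are $C^\infty$-limits of the loops $t\mapsto u(e^{2\pi(s_k+it)})$ for some sequence $s_k\to\infty$. **Theorem.** Let $r_0>0$. Then there exist a smooth function $\tilde F:S^1\times\mathbb{R}^{2n}\to\mathbb{R}$ and a $J\in\mathcal{J}(S^1\times\mathbb{R}^{2n},\xi_0)$ such that through every point $(\theta_0,0,z)\in S^1\times\mathbb{R}^{2(n-1)}\times\mathbb{R}^2=S^1\times\mathbb{R}^{2n}$ with $|z|<r_0$ passes (the $u$-component of) a finite-energy plane for the data $(e^{\tilde F}\lambda_0,J)$ whose limit set is equal to the torus $S^1\times\{0\}\times\{|z|=r_0\}$. -/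

import Mathlib

open Set Filter Topology MeasureTheory
open scoped ContDiff ENNReal

noncomputable section

/-- The manifold `S¹ × ℝ²ⁿ`, where `S¹ = ℝ / 2πℤ` and `ℝ²ⁿ` is written as `ℂⁿ`, with
`zᵢ = xᵢ + √-1 yᵢ`. It is a group, and its points are written `(θ, z)`. -/
abbrev CircleSpace (n : ℕ) : Type := AddCircle (2 * Real.pi) × (Fin n → ℂ)

/-- The universal cover `ℝ × ℝ²ⁿ` of `S¹ × ℝ²ⁿ`. By translation it is also the tangent space of
`S¹ × ℝ²ⁿ` at every point: `(c, v)` is the tangent vector `c ∂_θ + v`. -/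
abbrev CoverSpace (n : ℕ) : Type := ℝ × (Fin n → ℂ)

/-- The covering projection `ℝ × ℝ²ⁿ → S¹ × ℝ²ⁿ`, `(t, z) ↦ (t mod 2π, z)`. It is a group
homomorphism and a local diffeomorphism. -/
def coverProj {n : ℕ} (x : CoverSpace n) : CircleSpace n := ((x.1 : AddCircle (2 * Real.pi)), x.2)

/-- Smoothness of a map from `S¹ × ℝ²ⁿ` to a normed space: its pullback to the universal cover
is smooth. -/
def SmoothOnCircleSpace {n : ℕ} {Y : Type*} [NormedAddCommGroup Y] [NormedSpace ℝ Y]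
    (f : CircleSpace n → Y) : Prop :=
  ContDiff ℝ ∞ (fun x : CoverSpace n => f (coverProj x))

/-- `f'` is a smooth lift of `f : X → S¹ × ℝ²ⁿ` to the universal cover. When `X` is a normed
space (hence simply connected), `f` is smooth if and only if it has a smooth lift. The lift is then
unique up to a translation by an element of `2πℤ`, and the differential of `f` is that of
the lift. -/
structure IsSmoothLift {n : ℕ} {X : Type*} [NormedAddCommGroup X] [NormedSpace ℝ X]
    (f' : X → CoverSpace n) (f : X → CircleSpace n) : Prop where
  smooth : ContDiff ℝ ∞ f'
  lift : ∀ x, coverProj (f' x) = f x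

/-! ### Differential forms -/

/-- The exterior derivative `dη` at `x` of a `1`-form `η` on a normed space, as a function of two
tangent vectors. -/
def extDerivOne {X : Type*} [NormedAddCommGroup X] [NormedSpace ℝ X]
    (η : X → X →L[ℝ] ℝ) (x v w : X) : ℝ :=
  extDeriv (fun y => ContinuousAlternatingMap.ofSubsingleton ℝ X ℝ (0 : Fin 1) (η y)) x ![v, w]

theorem extDerivOne_eq {X : Type*} [NormedAddCommGroup X] [NormedSpace ℝ X]
    (η : X → X →L[ℝ] ℝ) (x v w : X) :
    extDerivOne η x v w = fderiv ℝ η x v w - fderiv ℝ η x w v := by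
  have h : (fun y => ContinuousAlternatingMap.ofSubsingleton ℝ X ℝ (0 : Fin 1) (η y)) =
      (ContinuousAlternatingMap.ofSubsingletonLIE (𝕜 := ℝ) (E := X) (F := ℝ) (0 : Fin 1)) ∘ η := rfl
  unfold extDerivOne extDeriv
  rw [h, LinearIsometryEquiv.comp_fderiv]
  simp [ContinuousAlternatingMap.alternatizeUncurryFin_apply, Fin.sum_univ_two,
    Fin.removeNth, sub_eq_add_neg]

/-- A `1`-form on `S¹ × ℝ²ⁿ`. -/
abbrev CircleSpaceForm (n : ℕ) : Type := CircleSpace n → CoverSpace n →L[ℝ] ℝ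

/-- The exterior derivative of a `1`-form on `S¹ × ℝ²ⁿ`, computed in the chart
`x ↦ p + coverProj x` around the point `p`. -/
def CircleSpaceForm.d {n : ℕ} (lam : CircleSpaceForm n) (p : CircleSpace n)
    (v w : CoverSpace n) : ℝ :=
  extDerivOne (fun x : CoverSpace n => lam (p + coverProj x)) 0 v w

/-- The contact form `λ₀ = dθ + ∑ᵢ (xᵢ dyᵢ - yᵢ dxᵢ)` on `S¹ × ℝ²ⁿ`. -/
def lamZero (n : ℕ) : CircleSpaceForm n := fun p =>
  ContinuousLinearMap.fst ℝ ℝ (Fin n → ℂ) +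
    ∑ i : Fin n,
      ((p.2 i).re • (Complex.imCLM ∘L ContinuousLinearMap.proj (R := ℝ) i ∘L
          ContinuousLinearMap.snd ℝ ℝ (Fin n → ℂ)) -
        (p.2 i).im • (Complex.reCLM ∘L ContinuousLinearMap.proj (R := ℝ) i ∘L
          ContinuousLinearMap.snd ℝ ℝ (Fin n → ℂ)))

theorem lamZero_apply {n : ℕ} (p : CircleSpace n) (v : CoverSpace n) :
    lamZero n p v = v.1 + ∑ i, ((p.2 i).re * (v.2 i).im - (p.2 i).im * (v.2 i).re) := by
  simp [lamZero]

/-- The `1`-form `e^F λ`. -/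
def expMulForm {n : ℕ} (F : CircleSpace n → ℝ) (lam : CircleSpaceForm n) : CircleSpaceForm n :=
  fun p => Real.exp (F p) • lam p

/-- `X` is the Reeb vector field of `lam`: `λ(X) = 1` and `dλ(X, ·) = 0`. For a contact form there
is exactly one such `X`. -/
def IsReebField {n : ℕ} (lam : CircleSpaceForm n) (X : CircleSpace n → CoverSpace n) : Prop :=
  ∀ p, lam p (X p) = 1 ∧ ∀ v, lam.d p (X p) v = 0

/-- `J` is a smooth complex structure on `ξ = ker λ` compatible with `dλ`, that is
`J ∈ 𝒥(S¹ × ℝ²ⁿ, ξ)`. The bundle endomorphism of `ξ` is written as the restriction to `ξ` of a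
smooth endomorphism of the tangent bundle (every smooth endomorphism of `ξ` is one, since `ξ` is a
direct summand); the values outside `ξ` are irrelevant, here and below. -/
structure IsCompatibleJ {n : ℕ} (lam : CircleSpaceForm n)
    (J : CircleSpace n → CoverSpace n →L[ℝ] CoverSpace n) : Prop where
  smooth : SmoothOnCircleSpace J
  mapsTo : ∀ p v, lam p v = 0 → lam p (J p v) = 0
  sq : ∀ p v, lam p v = 0 → J p (J p v) = -v
  symm : ∀ p v w, lam p v = 0 → lam p w = 0 → lam.d p v (J p w) = lam.d p w (J p v)
  pos : ∀ p v, lam p v = 0 → v ≠ 0 → 0 < lam.d p v (J p v)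

/-! ### Pseudoholomorphic planes -/

/-- The `ℝ`-invariant almost complex structure on `ℝ × (S¹ × ℝ²ⁿ)`, at a point over `p`:
it maps `∂_a` to the Reeb vector `X p`, hence `X p` to `-∂_a`, and it is `J` on `ξ`. Here
`v - λ(v) X` is the projection of `v` to `ξ` along `X`. -/
def symplectizationJ {n : ℕ} (lam : CircleSpaceForm n) (X : CircleSpace n → CoverSpace n)
    (J : CircleSpace n → CoverSpace n →L[ℝ] CoverSpace n) (p : CircleSpace n)
    (v : ℝ × CoverSpace n) : ℝ × CoverSpace n :=
  (-(lam p v.2), v.1 • X p + J p (v.2 - lam p v.2 • X p))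

/-- `(a, u) : ℂ → ℝ × (S¹ × ℝ²ⁿ)` is a pseudoholomorphic plane for the data `(λ, J)`; the map `u`
is given together with a smooth lift `u'`. -/
structure IsPseudoholomorphicPlane {n : ℕ} (lam : CircleSpaceForm n)
    (J : CircleSpace n → CoverSpace n →L[ℝ] CoverSpace n)
    (a : ℂ → ℝ) (u : ℂ → CircleSpace n) (u' : ℂ → CoverSpace n) : Prop where
  smooth : ContDiff ℝ ∞ a
  lift : IsSmoothLift u' u
  holomorphic : ∃ X, IsReebField lam X ∧ ∀ ζ w : ℂ,
    (fderiv ℝ a ζ (Complex.I * w), fderiv ℝ u' ζ (Complex.I * w)) =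
      symplectizationJ lam X J (u ζ) (fderiv ℝ a ζ w, fderiv ℝ u' ζ w)

/-- The functions `φ` in the definition of the Hofer energy. -/
structure IsEnergyCutoff (φ : ℝ → ℝ) : Prop where
  smooth : ContDiff ℝ ∞ φ
  mem_Icc : ∀ s, φ s ∈ Icc (0 : ℝ) 1
  deriv_nonneg : ∀ s, 0 ≤ deriv φ s
  tendsto_bot : Tendsto φ atBot (𝓝 0)
  tendsto_top : Tendsto φ atTop (𝓝 1)

/-- The Hofer energy `sup_φ ∫_ℂ d(φ(a) u^*λ)` of a pseudoholomorphic plane `(a, u)`, in terms of a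
smooth lift `u'` of `u`. For pseudoholomorphic maps with compatible `J` the integrand, which is
the value of the `2`-form on the oriented frame `(1, √-1)` of `ℂ`, is nonnegative; so the integral
is one of a nonnegative function, with values in `[0, ∞]`. -/
def hoferEnergy {n : ℕ} (lam : CircleSpaceForm n) (a : ℂ → ℝ) (u' : ℂ → CoverSpace n) : ℝ≥0∞ :=
  ⨆ (φ : ℝ → ℝ) (_ : IsEnergyCutoff φ), ∫⁻ ζ : ℂ, ENNReal.ofReal
    (extDerivOne (fun η : ℂ => φ (a η) • (lam (coverProj (u' η))).comp (fderiv ℝ u' η))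
      ζ 1 Complex.I)

/-- A finite-energy plane for the data `(λ, J)`. -/
def IsFiniteEnergyPlane {n : ℕ} (lam : CircleSpaceForm n)
    (J : CircleSpace n → CoverSpace n →L[ℝ] CoverSpace n)
    (a : ℂ → ℝ) (u : ℂ → CircleSpace n) : Prop :=
  ∃ u', IsPseudoholomorphicPlane lam J a u u' ∧ hoferEnergy lam a u' < ⊤

/-! ### Limit sets -/

/-- `γ` is a periodic orbit of the Reeb vector field, as a loop parametrized by `ℝ / ℤ`, that is a
`1`-periodic map on `ℝ` with `γ' = T X(γ)`, where `T > 0` is the period. -/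
def IsPeriodicReebOrbit {n : ℕ} (lam : CircleSpaceForm n) (γ : ℝ → CircleSpace n) : Prop :=
  Function.Periodic γ 1 ∧ ∃ X γ', IsReebField lam X ∧ IsSmoothLift γ' γ ∧
    ∃ T : ℝ, 0 < T ∧ ∀ t, deriv γ' t = T • X (γ t)

/-- `C^∞`-convergence of a sequence of loops in `S¹ × ℝ²ⁿ` (`1`-periodic maps on `ℝ`): for suitable
lifts to the universal cover, all derivatives converge uniformly over a period. -/
def TendstoLoops {n : ℕ} (c : ℕ → ℝ → CircleSpace n) (γ : ℝ → CircleSpace n) : Prop :=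
  ∃ (c' : ℕ → ℝ → CoverSpace n) (γ' : ℝ → CoverSpace n),
    (∀ k, IsSmoothLift (c' k) (c k)) ∧ IsSmoothLift γ' γ ∧
    ∀ j : ℕ, TendstoUniformlyOn (fun k => iteratedDeriv j (c' k)) (iteratedDeriv j γ') atTop
      (Icc 0 1)

/-- The loop `t ↦ u(e^{2π(s + it)})`. -/
def planeLoop {n : ℕ} (u : ℂ → CircleSpace n) (s t : ℝ) : CircleSpace n :=
  u (Complex.exp (2 * Real.pi * (s + t * Complex.I)))

/-- The limit orbits of a plane: the periodic Reeb orbits that are `C^∞`-limits of the loops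
`u(e^{2π(s_k + it)})` for some sequence `s_k → ∞`. -/
def IsLimitOrbit {n : ℕ} (lam : CircleSpaceForm n) (u : ℂ → CircleSpace n)
    (γ : ℝ → CircleSpace n) : Prop :=
  IsPeriodicReebOrbit lam γ ∧
    ∃ s : ℕ → ℝ, Tendsto s atTop atTop ∧ TendstoLoops (fun k => planeLoop u (s k)) γ

/-- The limit set of a plane, as a subset of `S¹ × ℝ²ⁿ`: the union of its limit orbits. -/
def limitSet {n : ℕ} (lam : CircleSpaceForm n) (u : ℂ → CircleSpace n) : Set (CircleSpace n) :=
  {p | ∃ γ, IsLimitOrbit lam u γ ∧ p ∈ range γ}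

/-- The point `(θ, 0, z)` of `S¹ × ℝ²⁽ⁿ⁻¹⁾ × ℝ² = S¹ × ℝ²ⁿ`, with `n = m + 1`. -/
def lastFactorPoint {m : ℕ} (θ : AddCircle (2 * Real.pi)) (z : ℂ) : CircleSpace (m + 1) :=
  (θ, Pi.single (Fin.last m) z)

end

/-! Let `F` depend only on `θ` and `σ = |z|²`, with `z` the last coordinate, and let `J` be
multiplication by `√-1` lifted to `ker λ₀`. Look for planes `u(ζ) = (ϑ(s), 0, ζ e^{g(s)})` with `s =
log |ζ|`. The Cauchy-Riemann equation then reduces to an ODE: `ϑ' = σ² F_θ / 2`, `σ' = 2σ(1 + σ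
F_σ)`, `a' = σ e^F`, while `Im g` rotates so as to make `u_s` tangent to the contact structure. Up
to the choice of metric, `(ϑ, σ)` follows the gradient flow of `log σ + F`.

It remains to find `F` whose gradient lines all spiral onto the circle `σ = σ₀ = r₀²` without
converging to a point of it, as a gradient flow that is smooth but not analytic can do. In
`exists_spiralProfile`, `σ e^F` equals `σ` near the axis and a constant for `σ ≥ σ₀`. In between it
is, with `y = 1/(σ₀ - σ)`, `E = e^{-y}` and `τ = θ - y`, the function `σ₀ + 4 - E(1 - (cos τ + sin
τ)/2) - E²`. Its `σ`-derivative `y² E (1 - cos τ) + 2 y² E²` is positive, but on the spiral `τ = 0`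
it is of order `y² E²`, whereas the `θ`-derivative there is `E / 2`. Near `σ₀` the flow therefore
crosses the spiral only towards larger `θ`. A trajectory stays ahead of one branch of the spiral,
and `ϑ → ∞` as `σ → σ₀` (`SpiralProfile.exists_trajectory`).

Near the axis `F = 0` and the solution is `ζ ↦ (ϑ₀, ζ e^{g₀})`, so the plane is smooth at the origin
(`cauchyRiemann`). The energy is bounded because `σ e^F` is (`hoferEnergy_lt_top`). Every circle
over `σ = σ₀` is a closed Reeb orbit. As `ϑ` is unbounded, every angle recurs at arbitrarily late
times, and the limit set is the whole torus (`limitSet_eq`). -/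

noncomputable section

/-! ### Global solutions of bounded Lipschitz ODEs -/

/-- A solution of speed at most `M` cannot leave the ball of radius `M(n + 1)` within time `n + 1`,
so Picard-Lindelöf applies on each interval `[-(n + 1), n + 1]`. Uniqueness glues these solutions.
-/
theorem exists_hasDerivAt_of_bounded_lipschitz {E : Type*} [NormedAddCommGroup E]
    [NormedSpace ℝ E] [CompleteSpace E] {V : E → E} {K M : NNReal} (hK : LipschitzWith K V)
    (hM : ∀ x, ‖V x‖ ≤ M) (x₀ : E) :
    ∃ γ : ℝ → E, γ 0 = x₀ ∧ ∀ s, HasDerivAt γ (V (γ s)) s := by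
  have local_sol : ∀ n : ℕ, ∃ γ : ℝ → E, γ 0 = x₀ ∧
      ∀ s ∈ Ioo (-(n + 1 : ℝ)) (n + 1), HasDerivAt γ (V (γ s)) s := by
    intro n
    have hn : (0 : ℝ) ∈ Icc (-(n + 1 : ℝ)) (n + 1) := by constructor <;> linarith [n.cast_nonneg (α := ℝ)]
    have hp : IsPicardLindelof (fun _ => V) (⟨0, hn⟩ : Icc (-(n + 1 : ℝ)) (n + 1)) x₀
        (M * (n + 1)) 0 M K := by
      refine IsPicardLindelof.of_time_independent (fun x _ => hM x) hK.lipschitzOnWith ?_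
      simp
    obtain ⟨γ, h0, h⟩ := hp.exists_eq_forall_mem_Icc_hasDerivWithinAt₀
    exact ⟨γ, h0, fun s hs => (h s ⟨hs.1.le, hs.2.le⟩).hasDerivAt (Icc_mem_nhds hs.1 hs.2)⟩
  choose γ h0 hγ using local_sol
  have agree : ∀ m n : ℕ, m ≤ n → EqOn (γ m) (γ n) (Ioo (-(m + 1 : ℝ)) (m + 1)) := by
    intro m n hmn
    have hmn' : (m : ℝ) ≤ n := by exact_mod_cast hmn
    refine ODE_solution_unique_of_mem_Ioo (v := fun _ => V) (s := fun _ => univ) (K := K) (t₀ := 0)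
      (fun _ _ => hK.lipschitzOnWith) ?_ (fun t ht => ⟨hγ m t ht, trivial⟩)
      (fun t ht => ⟨hγ n t ⟨by linarith [ht.1], by linarith [ht.2]⟩, trivial⟩) (by rw [h0, h0])
    constructor <;> linarith [m.cast_nonneg (α := ℝ)]
  have mem : ∀ s : ℝ, s ∈ Ioo (-((⌈|s|⌉₊ : ℕ) + 1 : ℝ)) ((⌈|s|⌉₊ : ℕ) + 1) := by
    intro s
    have := Nat.le_ceil |s|
    constructor <;> linarith [neg_abs_le s, le_abs_self s]
  refine ⟨fun s => γ ⌈|s|⌉₊ s, by simp [h0], fun s => ?_⟩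
  refine (hγ _ s (mem s)).congr_of_eventuallyEq ?_
  filter_upwards [Ioo_mem_nhds (mem s).1 (mem s).2] with r hr
  rcases le_total ⌈|s|⌉₊ ⌈|r|⌉₊ with h | h
  · exact (agree _ _ h hr).symm
  · exact agree _ _ h (mem r)

theorem contDiff_of_hasDerivAt_comp {E : Type*} [NormedAddCommGroup E] [NormedSpace ℝ E]
    {V : E → E} (hV : ContDiff ℝ ∞ V) {γ : ℝ → E} (hγ : ∀ s, HasDerivAt γ (V (γ s)) s) :
    ContDiff ℝ ∞ γ := by
  refine contDiff_infty.2 fun n => ?_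
  induction n with
  | zero => exact contDiff_zero.2 (continuous_iff_continuousAt.2 fun s => (hγ s).continuousAt)
  | succ n ih =>
    rw [show ((n + 1 : ℕ) : WithTop ℕ∞) = n + 1 from rfl]
    refine contDiff_succ_iff_deriv.2 ⟨fun s => (hγ s).differentiableAt, by simp, ?_⟩
    rw [show deriv γ = V ∘ γ from funext fun s => (hγ s).deriv]
    exact (hV.of_le (by exact_mod_cast le_top)).comp ih

/-- Periodicity in `t` and constancy for `l` outside `[A, B]` reduce bounds on `v` and on its
derivative to a compact rectangle. -/
theorem lipschitz_and_bounded_of_periodic {E : Type*} [NormedAddCommGroup E] [NormedSpace ℝ E]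
    {v : ℝ × ℝ → E} {P A B : ℝ} (hP : 0 < P) (hv : ContDiff ℝ ∞ v)
    (hper : ∀ t l, v (t + P, l) = v (t, l))
    (hlow : ∀ t l, l < A → v (t, l) = v (0, A)) (hhigh : ∀ t l, B < l → v (t, l) = v (0, B)) :
    ∃ K M : NNReal, LipschitzWith K v ∧ ∀ q, ‖v q‖ ≤ M := by
  have key : ∀ {G : Type _} [NormedAddCommGroup G] (g : ℝ × ℝ → G), Continuous g →
      (∀ t l, g (t + P, l) = g (t, l)) → (∀ t l, l < A → g (t, l) = g (0, A)) →
      (∀ t l, B < l → g (t, l) = g (0, B)) → ∃ M : NNReal, ∀ q, ‖g q‖ ≤ M := by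
    intro G _ g hg hp hl hh
    obtain ⟨M, hM⟩ := ((isCompact_Icc (a := 0) (b := P)).prod
      (isCompact_Icc (a := A) (b := B))).exists_bound_of_continuousOn hg.continuousOn
    refine ⟨⟨max (max M ‖g (0, A)‖) ‖g (0, B)‖, le_max_of_le_right (norm_nonneg _)⟩, ?_⟩
    rintro ⟨t, l⟩
    change _ ≤ max (max M ‖g (0, A)‖) ‖g (0, B)‖
    rcases lt_or_ge l A with h | h
    · rw [hl t l h]; exact le_max_of_le_left (le_max_right _ _)
    rcases lt_or_ge B l with h' | h'
    · rw [hh t l h']; exact le_max_right _ _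
    have hper' : Function.Periodic (fun t => g (t, l)) P := fun t => hp t l
    obtain ⟨t', ht', e⟩ := hper'.exists_mem_Ico₀ hP t
    change g (t, l) = g (t', l) at e
    rw [e]
    exact le_max_of_le_left (le_max_of_le_left (hM (t', l) ⟨⟨ht'.1, ht'.2.le⟩, h, h'⟩))
  obtain ⟨M, hM⟩ := key v hv.continuous hper hlow hhigh
  have zero_of : ∀ t l, (∀ᶠ q in 𝓝 ((t, l) : ℝ × ℝ), v q = v (t, l)) → fderiv ℝ v (t, l) = 0 := by
    intro t l h
    have h' : v =ᶠ[𝓝 (t, l)] fun _ => v (t, l) := h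
    rw [h'.fderiv_eq]; simp
  have zlow : ∀ t l, l < A → fderiv ℝ v (t, l) = 0 := by
    intro t l h
    refine zero_of t l ?_
    filter_upwards [(isOpen_lt continuous_snd continuous_const).mem_nhds h] with q hq
    rw [hlow t l h]; exact hlow q.1 q.2 hq
  have zhigh : ∀ t l, B < l → fderiv ℝ v (t, l) = 0 := by
    intro t l h
    refine zero_of t l ?_
    filter_upwards [(isOpen_lt continuous_const continuous_snd).mem_nhds h] with q hq
    rw [hhigh t l h]; exact hhigh q.1 q.2 hq
  -- Constancy is only given strictly outside `[A, B]`; continuity makes the derivative vanish at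
  -- the endpoints too, so that `key` applies to it.
  have hcont : Continuous (fderiv ℝ v) := hv.continuous_fderiv (by simp)
  have clow : ∀ t, fderiv ℝ v (t, A) = 0 := by
    intro t
    have hc : Continuous fun l => fderiv ℝ v (t, l) := hcont.comp (by fun_prop)
    refine tendsto_nhds_unique (hc.continuousAt.mono_left nhdsWithin_le_nhds :
      Tendsto _ (𝓝[<] A) _) (tendsto_const_nhds.congr' ?_)
    filter_upwards [self_mem_nhdsWithin] with l hl using (zlow t l hl).symm
  have chigh : ∀ t, fderiv ℝ v (t, B) = 0 := by
    intro t
    have hc : Continuous fun l => fderiv ℝ v (t, l) := hcont.comp (by fun_prop)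
    refine tendsto_nhds_unique (hc.continuousAt.mono_left nhdsWithin_le_nhds :
      Tendsto _ (𝓝[>] B) _) (tendsto_const_nhds.congr' ?_)
    filter_upwards [self_mem_nhdsWithin] with l hl using (zhigh t l hl).symm
  obtain ⟨K, hK⟩ := key (fderiv ℝ v) hcont (fun t l => by
      have h1 : (fun q : ℝ × ℝ => v (q + (P, 0))) = v := by
        ext ⟨a, b⟩; simpa using hper a b
      have h2 := fderiv_comp_add_right (𝕜 := ℝ) (f := v) (x := (t, l)) ((P, 0) : ℝ × ℝ)
      rw [h1] at h2
      rw [h2]; simp)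
    (fun t l h => by rw [zlow t l h, clow]) (fun t l h => by rw [zhigh t l h, chigh])
  exact ⟨K, M, lipschitzWith_of_nnnorm_fderiv_le (hv.differentiable (by simp)) hK, hM⟩

/-! ### A flat oscillating function -/

section FlatOscillation

open Polynomial

/-- `(p(1/x) cos(1/x) + q(1/x) sin(1/x)) e^{-1/x}` for `x > 0`, extended by zero. -/
def flatOsc (p q : ℝ[X]) (x : ℝ) : ℝ :=
  (p.eval x⁻¹ * expNegInvGlue x) * Real.cos x⁻¹ + (q.eval x⁻¹ * expNegInvGlue x) * Real.sin x⁻¹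

theorem flatOsc_of_nonpos (p q : ℝ[X]) {x : ℝ} (hx : x ≤ 0) : flatOsc p q x = 0 := by
  simp [flatOsc, expNegInvGlue.zero_of_nonpos hx]

theorem expNegInvGlue_of_pos {x : ℝ} (hx : 0 < x) : expNegInvGlue x = Real.exp (-x⁻¹) := by
  simp [expNegInvGlue, hx.not_ge]

theorem tendsto_flatOsc_zero (p q : ℝ[X]) : Tendsto (flatOsc p q) (𝓝 0) (𝓝 0) := by
  have h : ∀ (p : ℝ[X]) (c : ℝ → ℝ), (∀ x, |c x| ≤ 1) →
      Tendsto (fun x => (p.eval x⁻¹ * expNegInvGlue x) * c x) (𝓝 0) (𝓝 0) := by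
    intro p c hc
    have hz := (expNegInvGlue.tendsto_polynomial_inv_mul_zero p).norm
    rw [norm_zero] at hz
    refine squeeze_zero_norm (fun x => ?_) hz
    rw [norm_mul, Real.norm_eq_abs (c x)]
    exact mul_le_of_le_one_right (norm_nonneg (p.eval x⁻¹ * expNegInvGlue x)) (hc x)
  simpa using! (h p (fun x => Real.cos x⁻¹) fun x => Real.abs_cos_le_one _).add
    (h q (fun x => Real.sin x⁻¹) fun x => Real.abs_sin_le_one _)

/-- With `y = 1/x`, `d/dx = -y² d/dy` preserves the class of functions `(p(y) cos y + q(y) sin y)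
e^{-y}`. This closure gives smoothness by induction. -/
theorem hasDerivAt_flatOsc (p q : ℝ[X]) (x : ℝ) :
    HasDerivAt (flatOsc p q) (flatOsc (X ^ 2 * (p - derivative p - q))
      (X ^ 2 * (q - derivative q + p)) x) x := by
  rcases lt_trichotomy x 0 with hx | rfl | hx
  · rw [flatOsc_of_nonpos _ _ hx.le]
    refine (hasDerivAt_const x (0 : ℝ)).congr_of_eventuallyEq ?_
    filter_upwards [gt_mem_nhds hx] with y hy using flatOsc_of_nonpos _ _ hy.le
  · rw [flatOsc_of_nonpos _ _ le_rfl, hasDerivAt_iff_tendsto_slope]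
    -- The difference quotient at `0` is again in the class, with both polynomials multiplied by
    -- `X`.
    refine ((tendsto_flatOsc_zero (p * X) (q * X)).mono_left inf_le_left).congr fun x => ?_
    simp only [slope_def_field, flatOsc_of_nonpos p q le_rfl]
    simp only [flatOsc, eval_mul, eval_X, div_eq_mul_inv, sub_zero]
    ring
  · have hi := hasDerivAt_inv hx.ne'
    have he : HasDerivAt (fun y : ℝ => Real.exp (-y)) (-Real.exp (-x⁻¹)) x⁻¹ := by
      simpa using (hasDerivAt_neg x⁻¹).exp
    have h := (((p.hasDerivAt x⁻¹).mul he).mul (Real.hasDerivAt_cos x⁻¹)).add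
      (((q.hasDerivAt x⁻¹).mul he).mul (Real.hasDerivAt_sin x⁻¹))
    refine ((h.comp x hi).congr_of_eventuallyEq ?_).congr_deriv ?_
    · filter_upwards [lt_mem_nhds hx] with y hy
      simp [flatOsc, expNegInvGlue_of_pos hy]
    · simp only [flatOsc, expNegInvGlue_of_pos hx, eval_mul, eval_pow, eval_X, eval_sub, eval_add]
      simp
      ring

theorem contDiff_flatOsc (p q : ℝ[X]) : ContDiff ℝ ∞ (flatOsc p q) := by
  refine contDiff_infty.2 fun n => ?_
  induction n generalizing p q with
  | zero =>
    exact contDiff_zero.2 (continuous_iff_continuousAt.2 fun x =>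
      (hasDerivAt_flatOsc p q x).continuousAt)
  | succ n ih =>
    rw [show ((n + 1 : ℕ) : WithTop ℕ∞) = n + 1 from rfl]
    refine contDiff_succ_iff_deriv.2 ⟨fun x => (hasDerivAt_flatOsc p q x).differentiableAt,
      by simp, ?_⟩
    rw [show deriv (flatOsc p q) = _ from funext fun x => (hasDerivAt_flatOsc p q x).deriv]
    exact ih _ _

end FlatOscillation

/-! ### The spiral profile -/

/-- The properties of a function `F` of `θ` and `σ = |z|²` that are used to construct planes for the
contact form `e^F λ₀`. The contact form is standard near `σ = 0`; the circles around `σ = 0` are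
Reeb orbits for `σ ≥ σ₀`; and the gradient flow of `log σ + F` moves outwards for `σ < σ₀`, and
crosses the spiral `θ = 1 / (σ₀ - σ)` in one direction only. -/
structure SpiralProfile (σ₀ : ℝ) (F Fθ Fσ : ℝ × ℝ → ℝ) : Prop where
  pos : 0 < σ₀
  smooth : ContDiff ℝ ∞ F
  smooth_θ : ContDiff ℝ ∞ Fθ
  smooth_σ : ContDiff ℝ ∞ Fσ
  hasFDerivAt : ∀ q, HasFDerivAt F
    (Fθ q • ContinuousLinearMap.fst ℝ ℝ ℝ + Fσ q • ContinuousLinearMap.snd ℝ ℝ ℝ) q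
  periodic : ∀ t σ, F (t + 2 * Real.pi, σ) = F (t, σ)
  inner : ∀ t σ, σ ≤ σ₀ / 3 → F (t, σ) = 0
  outer_θ : ∀ t σ, σ₀ ≤ σ → Fθ (t, σ) = 0
  outer_σ : ∀ t σ, σ₀ ≤ σ → 1 + σ * Fσ (t, σ) = 0
  -- The bound is uniform in `t`, so compactness in `σ` alone gives a positive radial speed.
  lower : ∃ g : ℝ → ℝ, ContinuousOn g (Ioo 0 σ₀) ∧
    ∀ σ ∈ Ioo 0 σ₀, 0 < g σ ∧ ∀ t, g σ ≤ 1 + σ * Fσ (t, σ)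
  bounded : ∃ C : ℝ, ∀ t σ, 0 ≤ σ → σ * Real.exp (F (t, σ)) ≤ C
  -- The inequality compares the derivatives of `(σ₀ - σ)⁻¹` and of `ϑ` along the flow, at points of
  -- the spiral.
  barrier : ∃ σ₁ ∈ Ioo 0 σ₀, ∀ σ ∈ Ioo σ₁ σ₀, ∀ (t : ℝ) (k : ℤ),
    t = (σ₀ - σ)⁻¹ + k * (2 * Real.pi) →
    2 * σ * (1 + σ * Fσ (t, σ)) * ((σ₀ - σ)⁻¹) ^ 2 < σ ^ 2 * Fθ (t, σ) / 2

/-- The spiralling function that is interpolated with `σ` to give `σ e^F`. -/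
def spiralFun (σ₀ t σ : ℝ) : ℝ :=
  σ₀ + 4 - expNegInvGlue (σ₀ - σ) - expNegInvGlue (σ₀ - σ) ^ 2 +
    (Real.cos t * flatOsc 1 (-1) (σ₀ - σ) + Real.sin t * flatOsc 1 1 (σ₀ - σ)) / 2

/-- This form is used for estimates. The definition has the trigonometric functions of `t - (σ₀ -
σ)⁻¹` expanded, so that its smoothness at `σ₀` follows from that of `flatOsc`. -/
theorem spiralFun_eq (σ₀ t σ : ℝ) :
    spiralFun σ₀ t σ = σ₀ + 4 - expNegInvGlue (σ₀ - σ) *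
      (1 - (Real.cos (t - (σ₀ - σ)⁻¹) + Real.sin (t - (σ₀ - σ)⁻¹)) / 2) -
      expNegInvGlue (σ₀ - σ) ^ 2 := by
  simp only [spiralFun, flatOsc, Real.cos_sub, Real.sin_sub]
  simp
  ring

theorem contDiff_spiralFun (σ₀ : ℝ) : ContDiff ℝ ∞ fun q : ℝ × ℝ => spiralFun σ₀ q.1 q.2 := by
  have hs : ContDiff ℝ ∞ fun q : ℝ × ℝ => σ₀ - q.2 := by fun_prop
  have h : ∀ p q, ContDiff ℝ ∞ fun x : ℝ × ℝ => flatOsc p q (σ₀ - x.2) := fun p q =>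
    (contDiff_flatOsc p q).comp hs
  have hE : ContDiff ℝ ∞ fun x : ℝ × ℝ => expNegInvGlue (σ₀ - x.2) :=
    (expNegInvGlue.contDiff (n := ⊤)).comp hs
  unfold spiralFun
  exact ((contDiff_const.sub hE).sub (hE.pow 2)).add
    ((((Real.contDiff_cos.comp contDiff_fst).mul (h _ _)).add
      ((Real.contDiff_sin.comp contDiff_fst).mul (h _ _))).div_const 2)

theorem expNegInvGlue_le_one (x : ℝ) : expNegInvGlue x ≤ 1 := by
  rcases le_or_gt x 0 with h | h
  · simp [expNegInvGlue.zero_of_nonpos h]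
  · rw [expNegInvGlue_of_pos h, Real.exp_le_one_iff]
    simpa using h.le

/-- The constant `σ₀ + 4` leaves room for the subtracted terms, which are at most `3`. Exceeding
`σ₀` keeps the interpolation with `σ` increasing. -/
theorem spiralFun_mem_Icc (σ₀ t σ : ℝ) : spiralFun σ₀ t σ ∈ Icc (σ₀ + 1) (σ₀ + 4) := by
  rw [spiralFun_eq]
  have h0 := expNegInvGlue.nonneg (σ₀ - σ)
  have h1 := expNegInvGlue_le_one (σ₀ - σ)
  have := Real.neg_one_le_cos (t - (σ₀ - σ)⁻¹)
  have := Real.neg_one_le_sin (t - (σ₀ - σ)⁻¹)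
  have := Real.cos_le_one (t - (σ₀ - σ)⁻¹)
  have := Real.sin_le_one (t - (σ₀ - σ)⁻¹)
  set e := expNegInvGlue (σ₀ - σ)
  set b := 1 - (Real.cos (t - (σ₀ - σ)⁻¹) + Real.sin (t - (σ₀ - σ)⁻¹)) / 2 with hb
  have hb0 : 0 ≤ b := by rw [hb]; linarith
  have hb2 : b ≤ 2 := by rw [hb]; linarith
  constructor <;> nlinarith [mul_nonneg h0 hb0, mul_le_mul h1 hb2 hb0 zero_le_one]

theorem spiralFun_of_le {σ₀ σ : ℝ} (h : σ₀ ≤ σ) (t : ℝ) : spiralFun σ₀ t σ = σ₀ + 4 := by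
  simp [spiralFun_eq, expNegInvGlue.zero_of_nonpos (sub_nonpos.2 h)]

theorem hasDerivAt_spiralFun_left (σ₀ t σ : ℝ) :
    HasDerivAt (fun t => spiralFun σ₀ t σ) (expNegInvGlue (σ₀ - σ) *
      (Real.cos (t - (σ₀ - σ)⁻¹) - Real.sin (t - (σ₀ - σ)⁻¹)) / 2) t := by
  simp only [spiralFun_eq]
  have h := (hasDerivAt_id t).sub_const (σ₀ - σ)⁻¹
  have h2 := (((((h.cos.add h.sin).div_const 2).const_sub 1).const_mul
    (expNegInvGlue (σ₀ - σ))).const_sub (σ₀ + 4)).sub_const (expNegInvGlue (σ₀ - σ) ^ 2)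
  refine h2.congr_deriv ?_
  simp
  ring

/-- The sine terms cancel, which is why the sine was included. The part linear in `expNegInvGlue` is
nonnegative and vanishes exactly on the spiral, where only the quadratic part remains. -/
theorem hasDerivAt_spiralFun_right {σ₀ σ : ℝ} (hσ : σ < σ₀) (t : ℝ) :
    HasDerivAt (fun σ => spiralFun σ₀ t σ) (((σ₀ - σ)⁻¹) ^ 2 * expNegInvGlue (σ₀ - σ) *
      (1 - Real.cos (t - (σ₀ - σ)⁻¹)) +
      2 * ((σ₀ - σ)⁻¹) ^ 2 * expNegInvGlue (σ₀ - σ) ^ 2) σ := by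
  have hd : 0 < σ₀ - σ := sub_pos.2 hσ
  have hy : HasDerivAt (fun σ => (σ₀ - σ)⁻¹) (((σ₀ - σ)⁻¹) ^ 2) σ := by
    refine (((hasDerivAt_id σ).const_sub σ₀).fun_inv hd.ne').congr_deriv ?_
    simp
  have he := hy.fun_neg.exp
  have h := hy.const_sub t
  have h2 := ((he.mul (((h.cos.add h.sin).div_const 2).const_sub 1)).const_sub (σ₀ + 4)).sub
    (he.pow 2)
  refine (h2.congr_of_eventuallyEq ?_).congr_deriv ?_
  · filter_upwards [gt_mem_nhds hσ] with s hs
    rw [spiralFun_eq, expNegInvGlue_of_pos (sub_pos.2 hs)]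
    simp
  · rw [expNegInvGlue_of_pos hd]
    simp
    ring

/-- The cutoff function of `exists_spiralProfile`. -/
def profileCutoff (σ₀ σ : ℝ) : ℝ := Real.smoothTransition (3 / σ₀ * σ - 1)

theorem contDiff_profileCutoff (σ₀ : ℝ) : ContDiff ℝ ∞ (profileCutoff σ₀) :=
  (Real.smoothTransition.contDiff (n := ⊤)).comp (by fun_prop)

theorem profileCutoff_of_le {σ₀ σ : ℝ} (h0 : 0 < σ₀) (h : σ ≤ σ₀ / 3) : profileCutoff σ₀ σ = 0 := by
  refine Real.smoothTransition.zero_of_nonpos ?_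
  rw [div_mul_eq_mul_div, sub_nonpos, div_le_one h0]
  linarith

theorem profileCutoff_of_ge {σ₀ σ : ℝ} (h0 : 0 < σ₀) (h : 2 * σ₀ / 3 ≤ σ) :
    profileCutoff σ₀ σ = 1 := by
  refine Real.smoothTransition.one_of_one_le ?_
  rw [div_mul_eq_mul_div, le_sub_iff_add_le, le_div_iff₀ h0]
  linarith

theorem monotone_profileCutoff {σ₀ : ℝ} (h0 : 0 < σ₀) : Monotone (profileCutoff σ₀) :=
  fun a b hab => Real.smoothTransition.monotone (by gcongr)

theorem exists_spiralProfile {σ₀ : ℝ} (h0 : 0 < σ₀) :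
    ∃ F Fθ Fσ : ℝ × ℝ → ℝ, SpiralProfile σ₀ F Fθ Fσ := by
  set χ := profileCutoff σ₀ with hχ
  have χ0 : ∀ σ, 0 ≤ χ σ := fun σ => Real.smoothTransition.nonneg _
  have χ1 : ∀ σ, χ σ ≤ 1 := fun σ => Real.smoothTransition.le_one _
  have χin : ∀ σ, σ ≤ σ₀ / 3 → χ σ = 0 := fun σ h => profileCutoff_of_le h0 h
  have χsm : ContDiff ℝ ∞ χ := contDiff_profileCutoff σ₀
  have hk := fun t σ => spiralFun_mem_Icc σ₀ t σ
  -- This is `e^F`, chosen so that `σ f` interpolates between `σ` and `spiralFun`. The factor `σ⁻¹`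
  -- is harmless because the cutoff vanishes for `σ ≤ σ₀ / 3`.
  let f : ℝ × ℝ → ℝ := fun q => 1 - χ q.2 + χ q.2 * q.2⁻¹ * spiralFun σ₀ q.1 q.2
  have f_in : ∀ t σ, σ ≤ σ₀ / 3 → f (t, σ) = 1 := fun t σ h => by simp [f, χin σ h]
  have f_pos : ∀ q, 0 < f q := by
    rintro ⟨t, σ⟩
    rcases le_or_gt σ (σ₀ / 3) with h | h
    · rw [f_in t σ h]; exact one_pos
    · have hσ : 0 < σ := by linarith
      have hk' : 0 < spiralFun σ₀ t σ := by linarith [(hk t σ).1]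
      change 0 < 1 - χ σ + χ σ * σ⁻¹ * spiralFun σ₀ t σ
      rcases (χ0 σ).eq_or_lt with h | h
      · rw [← h]; norm_num
      · have := χ1 σ
        have : 0 < χ σ * σ⁻¹ * spiralFun σ₀ t σ := by positivity
        linarith
  have f_smooth : ContDiff ℝ ∞ f := by
    have hq : ContDiff ℝ ∞ fun σ => χ σ * σ⁻¹ := by
      rw [contDiff_iff_contDiffAt]
      intro σ
      rcases lt_or_ge 0 σ with h | h
      · exact χsm.contDiffAt.mul (contDiffAt_inv ℝ h.ne')
      · refine (contDiffAt_const (c := (0 : ℝ))).congr_of_eventuallyEq ?_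
        filter_upwards [gt_mem_nhds (show σ < σ₀ / 3 by linarith)] with s hs
        simp [χin s hs.le]
    exact (contDiff_const.sub (χsm.comp contDiff_snd)).add
      ((hq.comp contDiff_snd).mul (contDiff_spiralFun σ₀))
  let F : ℝ × ℝ → ℝ := fun q => Real.log (f q)
  have F_smooth : ContDiff ℝ ∞ F := f_smooth.log fun q => (f_pos q).ne'
  have expF : ∀ t σ, σ * Real.exp (F (t, σ)) = (1 - χ σ) * σ + χ σ * spiralFun σ₀ t σ := by
    intro t σ
    rw [Real.exp_log (f_pos _)]
    rcases eq_or_ne σ 0 with rfl | h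
    · simp [χin 0 (by linarith)]
    · simp only [f]; field_simp
  have F_fderiv : ∀ q, HasFDerivAt F (fderiv ℝ F q) q := fun q =>
    (F_smooth.differentiable (by simp) q).hasFDerivAt
  have dθ : ∀ t σ, HasDerivAt (fun t => F (t, σ)) (fderiv ℝ F (t, σ) (1, 0)) t := fun t σ =>
    (F_fderiv (t, σ)).comp_hasDerivAt (f := fun t => (t, σ)) t
      ((hasDerivAt_id t).prodMk (hasDerivAt_const t σ))
  have dσ : ∀ t σ, HasDerivAt (fun σ => F (t, σ)) (fderiv ℝ F (t, σ) (0, 1)) σ := fun t σ =>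
    (F_fderiv (t, σ)).comp_hasDerivAt (f := fun σ => (t, σ)) σ
      ((hasDerivAt_const σ t).prodMk (hasDerivAt_id σ))
  have hθ : ∀ t σ, σ * Real.exp (F (t, σ)) * fderiv ℝ F (t, σ) (1, 0) = χ σ *
      (expNegInvGlue (σ₀ - σ) *
        (Real.cos (t - (σ₀ - σ)⁻¹) - Real.sin (t - (σ₀ - σ)⁻¹)) / 2) := by
    intro t σ
    have h1 := (dθ t σ).exp.const_mul σ
    simp only [expF] at h1
    have h2 := ((hasDerivAt_spiralFun_left σ₀ t σ).const_mul (χ σ)).const_add ((1 - χ σ) * σ)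
    rw [← h1.unique h2]; ring
  have dχ : ∀ σ, HasDerivAt χ (deriv χ σ) σ := fun σ =>
    (χsm.differentiable (by simp) σ).hasDerivAt
  have dχ0 : ∀ σ, 0 ≤ deriv χ σ := fun σ => (monotone_profileCutoff h0).deriv_nonneg
  have hσ' : ∀ t σ k', HasDerivAt (fun σ => spiralFun σ₀ t σ) k' σ →
      Real.exp (F (t, σ)) * (1 + σ * fderiv ℝ F (t, σ) (0, 1)) =
        (1 - χ σ) + deriv χ σ * (spiralFun σ₀ t σ - σ) + χ σ * k' := by
    intro t σ k' hk'
    have h1 := (hasDerivAt_id σ).mul (dσ t σ).exp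
    have h2 := (((dχ σ).const_sub 1).mul (hasDerivAt_id σ)).add ((dχ σ).mul hk')
    have h3 := h1.congr_of_eventuallyEq (Eventually.of_forall fun s => (expF t s).symm)
    have h4 := h3.unique h2
    simp only [id] at h4
    linear_combination h4
  have out_k : ∀ t σ, σ₀ < σ → HasDerivAt (fun σ => spiralFun σ₀ t σ) 0 σ := by
    intro t σ h
    refine (hasDerivAt_const σ (σ₀ + 4)).congr_of_eventuallyEq ?_
    filter_upwards [lt_mem_nhds h] with s hs using spiralFun_of_le hs.le t
  have χout : ∀ σ, 2 * σ₀ / 3 < σ → deriv χ σ = 0 := by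
    intro σ h
    refine ((hasDerivAt_const σ (1 : ℝ)).congr_of_eventuallyEq ?_).deriv
    filter_upwards [lt_mem_nhds h] with s hs using profileCutoff_of_ge h0 hs.le
  have χone : ∀ σ, 2 * σ₀ / 3 ≤ σ → χ σ = 1 := fun σ h => profileCutoff_of_ge h0 h
  have hin : ∀ t σ, 0 < σ → σ < σ₀ →
      Real.exp (F (t, σ)) * (1 + σ * fderiv ℝ F (t, σ) (0, 1)) ≥
        (1 - χ σ) + χ σ * (2 * ((σ₀ - σ)⁻¹) ^ 2 * expNegInvGlue (σ₀ - σ) ^ 2) := by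
    intro t σ h1 h2
    rw [hσ' t σ _ (hasDerivAt_spiralFun_right h2 t)]
    have a := mul_nonneg (dχ0 σ) (show 0 ≤ spiralFun σ₀ t σ - σ by linarith [(hk t σ).1])
    have b : 0 ≤ ((σ₀ - σ)⁻¹) ^ 2 * expNegInvGlue (σ₀ - σ) * (1 - Real.cos (t - (σ₀ - σ)⁻¹)) :=
      mul_nonneg (mul_nonneg (sq_nonneg _) (expNegInvGlue.nonneg _))
        (sub_nonneg.2 (Real.cos_le_one _))
    nlinarith [mul_nonneg (χ0 σ) b]
  have hbd : ∀ t σ, 0 ≤ σ → σ * Real.exp (F (t, σ)) ≤ σ₀ + 4 := by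
    intro t σ hσ
    rw [expF]
    have h1 := (hk t σ).2
    rcases le_total (2 * σ₀ / 3) σ with h | h
    · simpa [χone σ h] using h1
    · nlinarith [χ0 σ, χ1 σ]
  refine ⟨F, fun q => fderiv ℝ F q (1, 0), fun q => fderiv ℝ F q (0, 1), ?_⟩
  have smd : ∀ v, ContDiff ℝ ∞ fun q => fderiv ℝ F q v := fun v =>
    (F_smooth.fderiv_right (m := ∞) (by simp)).clm_apply contDiff_const
  refine ⟨h0, F_smooth, smd _, smd _, fun q => ?_, fun t σ => ?_, fun t σ h => ?_, fun t σ h => ?_,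
    fun t σ h => ?_, ?_, ⟨σ₀ + 4, hbd⟩, ?_⟩
  · refine (F_fderiv q).congr_fderiv ?_
    ext <;> simp
  · have : spiralFun σ₀ (t + 2 * Real.pi) σ = spiralFun σ₀ t σ := by simp [spiralFun]
    simp [F, f, this]
  · simp [F, f_in t σ h]
  · have h1 := hθ t σ
    rw [expNegInvGlue.zero_of_nonpos (sub_nonpos.2 h)] at h1
    have : 0 < σ := h0.trans_le h
    have : σ * Real.exp (F (t, σ)) ≠ 0 := by positivity
    simpa [this] using h1
  · have key : ∀ σ, σ₀ < σ → 1 + σ * fderiv ℝ F (t, σ) (0, 1) = 0 := by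
      intro σ h
      have h1 := hσ' t σ 0 (out_k t σ h)
      rw [χout σ (by linarith), χone σ (by linarith)] at h1
      simpa [(Real.exp_pos _).ne'] using h1
    have hc : Continuous fun σ => 1 + σ * fderiv ℝ F (t, σ) (0, 1) :=
      continuous_const.add (continuous_id.mul ((smd (0, 1)).continuous.comp (by fun_prop)))
    -- The equation is computed for `σ > σ₀` and passes to `σ = σ₀` by continuity.
    rcases h.eq_or_lt with rfl | h
    · refine tendsto_nhds_unique (hc.continuousAt.mono_left nhdsWithin_le_nhds :
        Tendsto _ (𝓝[>] σ₀) _) (tendsto_const_nhds.congr' ?_)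
      filter_upwards [self_mem_nhdsWithin] with s hs using (key s hs).symm
    · exact key σ h
  -- The lower bound `hin` for `e^F (1 + σ F_σ)` is divided by `e^F`, using `σ e^F ≤ σ₀ + 4`.
  · refine ⟨fun σ => σ * ((1 - χ σ) + χ σ *
      (2 * ((σ₀ - σ)⁻¹) ^ 2 * expNegInvGlue (σ₀ - σ) ^ 2)) / (σ₀ + 4), ?_, fun σ hσ => ?_⟩
    · have hE : Continuous expNegInvGlue := (expNegInvGlue.contDiff (n := 0)).continuous
      have hi : ContinuousOn (fun σ => (σ₀ - σ)⁻¹) (Ioo 0 σ₀) :=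
        ContinuousOn.inv₀ (by fun_prop) fun σ hσ => (sub_pos.2 hσ.2).ne'
      have hEσ : ContinuousOn (fun σ => expNegInvGlue (σ₀ - σ)) (Ioo 0 σ₀) :=
        (hE.comp (by fun_prop : Continuous fun σ => σ₀ - σ)).continuousOn
      have := χsm.continuous.continuousOn (s := Ioo 0 σ₀)
      fun_prop
    · have hd : 0 < σ₀ - σ := sub_pos.2 hσ.2
      have hE := expNegInvGlue.pos_of_pos hd
      have hp : 0 < 2 * ((σ₀ - σ)⁻¹) ^ 2 * expNegInvGlue (σ₀ - σ) ^ 2 := by positivity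
      have hc : 0 < (1 - χ σ) + χ σ * (2 * ((σ₀ - σ)⁻¹) ^ 2 * expNegInvGlue (σ₀ - σ) ^ 2) := by
        rcases (χ0 σ).eq_or_lt with h | h
        · rw [← h]; norm_num
        · have := χ1 σ
          have := mul_pos h hp
          linarith
      have h4 : 0 < σ₀ + 4 := by linarith
      refine ⟨div_pos (mul_pos hσ.1 hc) h4, fun t => ?_⟩
      have h1 := hin t σ hσ.1 hσ.2
      have h2 := hbd t σ hσ.1.le
      rw [div_le_iff₀ h4]
      have e0 := Real.exp_pos (F (t, σ))
      have h5 : 0 ≤ 1 + σ * fderiv ℝ F (t, σ) (0, 1) := by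
        by_contra hneg
        nlinarith [mul_pos e0 (neg_pos.2 (not_le.1 hneg))]
      nlinarith [mul_le_mul_of_nonneg_left h1 hσ.1.le, mul_le_mul_of_nonneg_right h2 h5]
  -- With `y = (σ₀ - σ)⁻¹` and `E = e^{-y}`, the two sides times `e^F` are `4 σ y⁴ E²` and `σ E / 4`
  -- on the spiral. Their quotient `16 y⁴ E` tends to `0`.
  · have ht : Tendsto (fun x : ℝ => 16 * (x⁻¹ ^ 4 * expNegInvGlue x)) (𝓝 0) (𝓝 0) := by
      have := (expNegInvGlue.tendsto_polynomial_inv_mul_zero (Polynomial.X ^ 4)).const_mul 16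
      simpa only [Polynomial.eval_pow, Polynomial.eval_X, mul_zero] using this
    obtain ⟨ε, hε, hlt⟩ := Metric.eventually_nhds_iff.1 (ht.eventually_lt_const one_pos)
    refine ⟨max (2 * σ₀ / 3) (σ₀ - ε), ⟨lt_max_of_lt_left (by linarith), max_lt (by linarith)
      (by linarith)⟩, ?_⟩
    rintro σ ⟨hσ1, hσ2⟩ t k rfl
    have hσa := (max_lt_iff.1 hσ1).1
    have hd : 0 < σ₀ - σ := sub_pos.2 hσ2
    have hE := expNegInvGlue.pos_of_pos hd
    have hlt' := hlt (y := σ₀ - σ) (by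
      rw [Real.dist_eq, sub_zero, abs_of_pos hd]; linarith [(max_lt_iff.1 hσ1).2])
    set t := (σ₀ - σ)⁻¹ + k * (2 * Real.pi) with htdef
    have ht' : t - (σ₀ - σ)⁻¹ = k * (2 * Real.pi) := by rw [htdef]; ring
    have h1 := hθ t σ
    have h2 := hσ' t σ _ (hasDerivAt_spiralFun_right hσ2 t)
    have hcos : Real.cos (k * (2 * Real.pi)) = 1 := Real.cos_int_mul_two_pi k
    have hsin : Real.sin (k * (2 * Real.pi)) = 0 := by
      have := Real.sin_int_mul_pi (k * 2)
      push_cast at this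
      rw [← this]; congr 1; ring
    rw [ht', hcos, hsin, χone σ hσa.le] at h1
    rw [ht', hcos, χone σ hσa.le, χout σ hσa] at h2
    have hσ : 0 < σ := by linarith
    have e0 := Real.exp_pos (F (t, σ))
    refine lt_of_mul_lt_mul_left ?_ e0.le
    have l1 : Real.exp (F (t, σ)) * (2 * σ * (1 + σ * fderiv ℝ F (t, σ) (0, 1)) *
        ((σ₀ - σ)⁻¹) ^ 2) = σ * expNegInvGlue (σ₀ - σ) / 4 *
          (16 * ((σ₀ - σ)⁻¹ ^ 4 * expNegInvGlue (σ₀ - σ))) := by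
      linear_combination (2 * σ * ((σ₀ - σ)⁻¹) ^ 2) * h2
    have l2 : Real.exp (F (t, σ)) * (σ ^ 2 * fderiv ℝ F (t, σ) (1, 0) / 2) =
        σ * expNegInvGlue (σ₀ - σ) / 4 * 1 := by
      linear_combination (σ / 2) * h1
    rw [l1, l2]
    exact mul_lt_mul_of_pos_left hlt' (by positivity)

/-! ### Trajectories -/

namespace SpiralProfile

variable {σ₀ : ℝ} {F Fθ Fσ : ℝ × ℝ → ℝ}

theorem hasDerivAt_left (hF : SpiralProfile σ₀ F Fθ Fσ) (t σ : ℝ) :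
    HasDerivAt (fun t => F (t, σ)) (Fθ (t, σ)) t := by
  simpa using! (hF.hasFDerivAt (t, σ)).comp_hasDerivAt (f := fun t => (t, σ)) t
    ((hasDerivAt_id t).prodMk (hasDerivAt_const t σ))

theorem hasDerivAt_right (hF : SpiralProfile σ₀ F Fθ Fσ) (t σ : ℝ) :
    HasDerivAt (fun σ => F (t, σ)) (Fσ (t, σ)) σ := by
  simpa using! (hF.hasFDerivAt (t, σ)).comp_hasDerivAt (f := fun σ => (t, σ)) σ
    ((hasDerivAt_const σ t).prodMk (hasDerivAt_id σ))

theorem periodic_θ (hF : SpiralProfile σ₀ F Fθ Fσ) (t σ : ℝ) :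
    Fθ (t + 2 * Real.pi, σ) = Fθ (t, σ) := by
  have h := (hF.hasDerivAt_left (t + 2 * Real.pi) σ).comp_add_const t (2 * Real.pi)
  simp only [hF.periodic] at h
  exact h.unique (hF.hasDerivAt_left t σ)

theorem periodic_σ (hF : SpiralProfile σ₀ F Fθ Fσ) (t σ : ℝ) :
    Fσ (t + 2 * Real.pi, σ) = Fσ (t, σ) := by
  have h := hF.hasDerivAt_right (t + 2 * Real.pi) σ
  simp only [hF.periodic] at h
  exact h.unique (hF.hasDerivAt_right t σ)

theorem inner_θ (hF : SpiralProfile σ₀ F Fθ Fσ) (t : ℝ) {σ : ℝ} (h : σ < σ₀ / 3) :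
    Fθ (t, σ) = 0 := by
  have h1 := hF.hasDerivAt_left t σ
  simp only [hF.inner _ _ h.le] at h1
  exact h1.unique (hasDerivAt_const t 0)

theorem inner_σ (hF : SpiralProfile σ₀ F Fθ Fσ) (t : ℝ) {σ : ℝ} (h : σ < σ₀ / 3) :
    Fσ (t, σ) = 0 := by
  refine (hF.hasDerivAt_right t σ).unique
    ((hasDerivAt_const σ (0 : ℝ)).congr_of_eventuallyEq ?_)
  filter_upwards [gt_mem_nhds h] with s hs using hF.inner t s hs.le

theorem exp_outer (hF : SpiralProfile σ₀ F Fθ Fσ) : ∃ C > 0, ∀ t, Real.exp (F (t, σ₀)) = C := by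
  refine ⟨Real.exp (F (0, σ₀)), Real.exp_pos _, fun t => ?_⟩
  have : ∀ t, HasDerivAt (fun t => F (t, σ₀)) 0 t := fun t => by
    simpa [hF.outer_θ t σ₀ le_rfl] using hF.hasDerivAt_left t σ₀
  rw [is_const_of_deriv_eq_zero (fun t => (this t).differentiableAt) (fun t => (this t).deriv) t 0]

end SpiralProfile

/-- The radial data of a plane: `u(ζ) = (ϑ(s), ζ e^{g(s)})` with `s = log |ζ|`. The trajectory is
normalized to be trivial for `s ≤ 1`, and it spirals outwards to `σ = σ₀`. -/
structure SpiralTrajectory (σ₀ : ℝ) (Fθ Fσ : ℝ × ℝ → ℝ) (ϑ : ℝ → ℝ) (g : ℝ → ℂ) (σ : ℝ → ℝ) :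
    Prop where
  eq_σ : ∀ s, σ s = Real.exp (2 * (s + (g s).re))
  smooth_ϑ : ContDiff ℝ ∞ ϑ
  smooth_g : ContDiff ℝ ∞ g
  deriv_ϑ : ∀ s, HasDerivAt ϑ (σ s ^ 2 * Fθ (ϑ s, σ s) / 2) s
  deriv_g : ∀ s, HasDerivAt g (σ s * Fσ (ϑ s, σ s) - Complex.I / 2 * (σ s * Fθ (ϑ s, σ s))) s
  small : ∀ s ≤ 1, σ s < σ₀ / 3
  const : ∀ s, σ s < σ₀ / 3 → ϑ s = ϑ 0 ∧ g s = g 0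
  lt : ∀ s, σ s < σ₀
  tendsto_σ : Tendsto σ atTop (𝓝 σ₀)
  tendsto_ϑ : Tendsto ϑ atTop atTop

/-- The unknown is `w = s + g`, a logarithm of the last coordinate. In it the ODE is autonomous,
depends only on `ϑ` and `Re w`, and is constant both near the axis and for `σ ≥ σ₀`, hence bounded
and Lipschitz. -/
theorem SpiralProfile.exists_curve {σ₀ : ℝ} {F Fθ Fσ : ℝ × ℝ → ℝ}
    (hF : SpiralProfile σ₀ F Fθ Fσ) (t₀ : ℝ) (w₀ : ℂ) (hw₀ : Real.exp (2 * w₀.re) < σ₀) :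
    ∃ (ϑ : ℝ → ℝ) (w : ℝ → ℂ), ϑ 0 = t₀ ∧ w 0 = w₀ ∧ ContDiff ℝ ∞ ϑ ∧ ContDiff ℝ ∞ w ∧
      (∀ s, HasDerivAt ϑ (Real.exp (2 * (w s).re) ^ 2 * Fθ (ϑ s, Real.exp (2 * (w s).re)) / 2) s) ∧
      (∀ s, HasDerivAt w (1 + (Real.exp (2 * (w s).re) * Fσ (ϑ s, Real.exp (2 * (w s).re)) -
        Complex.I / 2 * (Real.exp (2 * (w s).re) * Fθ (ϑ s, Real.exp (2 * (w s).re))))) s) ∧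
      ∀ s, Real.exp (2 * (w s).re) < σ₀ := by
  have h0 := hF.pos
  let v : ℝ × ℝ → ℝ × ℂ := fun q => (Real.exp (2 * q.2) ^ 2 * Fθ (q.1, Real.exp (2 * q.2)) / 2,
    1 + (((Real.exp (2 * q.2) * Fσ (q.1, Real.exp (2 * q.2)) : ℝ) : ℂ) -
        Complex.I / 2 * ((Real.exp (2 * q.2) * Fθ (q.1, Real.exp (2 * q.2)) : ℝ) : ℂ)))
  have hexp : ContDiff ℝ ∞ fun q : ℝ × ℝ => Real.exp (2 * q.2) := by fun_prop
  have hθ : ContDiff ℝ ∞ fun q : ℝ × ℝ => Fθ (q.1, Real.exp (2 * q.2)) :=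
    hF.smooth_θ.comp (contDiff_fst.prodMk hexp)
  have hσ : ContDiff ℝ ∞ fun q : ℝ × ℝ => Fσ (q.1, Real.exp (2 * q.2)) :=
    hF.smooth_σ.comp (contDiff_fst.prodMk hexp)
  have hv : ContDiff ℝ ∞ v :=
    (((hexp.pow 2).mul hθ).div_const 2).prodMk (contDiff_const.add
      ((Complex.ofRealCLM.contDiff.comp (hexp.mul hσ)).sub
        (contDiff_const.mul (Complex.ofRealCLM.contDiff.comp (hexp.mul hθ)))))
  have vlow : ∀ t l, Real.exp (2 * l) < σ₀ / 3 → v (t, l) = (0, 1) := by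
    intro t l h
    simp [v, hF.inner_θ t h, hF.inner_σ t h]
  have vhigh : ∀ t l, σ₀ ≤ Real.exp (2 * l) → v (t, l) = 0 := by
    intro t l h
    have h1 := hF.outer_θ t _ h
    have h2 := hF.outer_σ t _ h
    have h3 : (1 : ℂ) + ((Real.exp (2 * l) * Fσ (t, Real.exp (2 * l)) : ℝ) : ℂ) = 0 := by
      rw [← Complex.ofReal_one, ← Complex.ofReal_add, h2, Complex.ofReal_zero]
    simp only [v, h1, mul_zero, zero_div, Complex.ofReal_zero, sub_zero, h3]
    rfl
  have exp_half_log : ∀ x : ℝ, 0 < x → Real.exp (2 * (Real.log x / 2)) = x := fun x hx => by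
    rw [mul_div_cancel₀ _ two_ne_zero, Real.exp_log hx]
  -- Any level strictly below `σ₀ / 3` serves for `A`: the field must already be constant at `A`
  -- itself.
  obtain ⟨K, M, hK, hM⟩ := lipschitz_and_bounded_of_periodic (P := 2 * Real.pi)
    (A := Real.log (σ₀ / 4) / 2) (B := Real.log σ₀ / 2) (by positivity) hv
    (fun t l => by simp only [v, hF.periodic_θ, hF.periodic_σ])
    (fun t l h => by
      have h1 := exp_half_log (σ₀ / 4) (by positivity)
      rw [vlow t l (lt_trans (Real.exp_lt_exp.2 (mul_lt_mul_of_pos_left h two_pos))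
        (by rw [h1]; linarith)), vlow 0 _ (by rw [h1]; linarith)])
    (fun t l h => by
      have h1 := exp_half_log σ₀ h0
      rw [vhigh t l (le_trans h1.ge (Real.exp_le_exp.2 (by linarith))), vhigh 0 _ h1.ge])
  let V : ℝ × ℂ → ℝ × ℂ := fun x => v (x.1, x.2.re)
  have hproj : LipschitzWith 1 fun x : ℝ × ℂ => (x.1, x.2.re) := by
    refine LipschitzWith.of_dist_le_mul fun x y => ?_
    simp only [NNReal.coe_one, one_mul, Prod.dist_eq]
    refine max_le_max le_rfl ?_
    rw [Real.dist_eq, Complex.dist_eq, ← Complex.sub_re]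
    exact Complex.abs_re_le_norm _
  have hVK : LipschitzWith (K * 1) V := hK.comp hproj
  have hVs : ContDiff ℝ ∞ V :=
    hv.comp (contDiff_fst.prodMk (Complex.reCLM.contDiff.comp contDiff_snd))
  obtain ⟨γ, hγ0, hγ⟩ := exists_hasDerivAt_of_bounded_lipschitz hVK (fun x => hM _) (t₀, w₀)
  have hγs := contDiff_of_hasDerivAt_comp hVs hγ
  refine ⟨fun s => (γ s).1, fun s => (γ s).2, by simp [hγ0], by simp [hγ0],
    contDiff_fst.comp hγs, contDiff_snd.comp hγs, fun s => ?_, fun s => ?_, fun s => ?_⟩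
  · exact (hasFDerivAt_fst (𝕜 := ℝ) (p := γ s)).comp_hasDerivAt s (hγ s)
  · refine ((hasFDerivAt_snd (𝕜 := ℝ) (p := γ s)).comp_hasDerivAt s (hγ s)).congr_deriv ?_
    simp [V, v]
  -- Points with `σ ≥ σ₀` are equilibria, so by uniqueness a trajectory starting below `σ₀` never
  -- reaches them.
  · by_contra hs
    have hz : V (γ s) = 0 := vhigh _ _ (not_lt.1 hs)
    have := ODE_solution_unique_univ (v := fun _ => V) (s := fun _ => univ) (t₀ := s)
      (fun _ => hVK.lipschitzOnWith) (fun t => ⟨hγ t, trivial⟩)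
      (g := fun _ => γ s) (fun t => ⟨by simpa [hz] using hasDerivAt_const t (γ s), trivial⟩) rfl
    have h1 := congrFun this 0
    rw [hγ0] at h1
    simp only [← h1] at hs
    exact hs hw₀

/-- Radial speed is bounded below on compact ranges of `σ` in `(0, σ₀)`, so `σ` enters the trivial
region backwards in time and tends to `σ₀` forwards. The barrier forces `ϑ → ∞`. A time shift
normalizes the solution. -/
theorem SpiralProfile.exists_trajectory {σ₀ : ℝ} {F Fθ Fσ : ℝ × ℝ → ℝ}
    (hF : SpiralProfile σ₀ F Fθ Fσ) (t₀ : ℝ) (w₀ : ℂ) (hw₀ : Real.exp (2 * w₀.re) < σ₀) :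
    ∃ (ϑ : ℝ → ℝ) (g : ℝ → ℂ) (σ : ℝ → ℝ) (s₀ : ℝ), SpiralTrajectory σ₀ Fθ Fσ ϑ g σ ∧
      ϑ s₀ = t₀ ∧ s₀ + g s₀ = w₀ := by
  obtain ⟨ϑ, w, hϑ0, hw0, sϑ, sw, dϑ, dw, hlt⟩ := hF.exists_curve t₀ w₀ hw₀
  have h0 := hF.pos
  set l : ℝ → ℝ := fun s => (w s).re with hl
  set σ : ℝ → ℝ := fun s => Real.exp (2 * l s) with hσ
  have dl : ∀ s, HasDerivAt l (1 + σ s * Fσ (ϑ s, σ s)) s := by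
    intro s
    have := (Complex.reCLM.hasFDerivAt (x := w s)).comp_hasDerivAt s (dw s)
    refine this.congr_deriv ?_
    simp [hσ, hl, -Complex.ofReal_exp]
  have σpos : ∀ s, 0 < σ s := fun s => Real.exp_pos _
  have dσ : ∀ s, HasDerivAt σ (2 * σ s * (1 + σ s * Fσ (ϑ s, σ s))) s := by
    intro s
    refine ((dl s).const_mul 2).exp.congr_deriv ?_
    simp only [hσ]; ring
  obtain ⟨G, Gcont, hG⟩ := hF.lower
  have dl_pos : ∀ s, 0 < 1 + σ s * Fσ (ϑ s, σ s) := fun s =>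
    (hG (σ s) ⟨σpos s, hlt s⟩).1.trans_le ((hG (σ s) ⟨σpos s, hlt s⟩).2 _)
  have lmono : StrictMono l := strictMono_of_deriv_pos fun s => by rw [(dl s).deriv]; exact dl_pos s
  have σmono : StrictMono σ := fun a b h =>
    Real.exp_lt_exp.2 (mul_lt_mul_of_pos_left (lmono h) two_pos)
  have lcont : Continuous l := continuous_iff_continuousAt.2 fun s => (dl s).continuousAt
  have unif : ∀ α β, Real.exp (2 * β) < σ₀ → ∃ c > 0, ∀ s, l s ∈ Icc α β →
      c ≤ 1 + σ s * Fσ (ϑ s, σ s) := by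
    intro α β hβ
    have hmaps : ∀ x ∈ Icc α β, Real.exp (2 * x) ∈ Ioo 0 σ₀ := fun x hx =>
      ⟨Real.exp_pos _, (Real.exp_le_exp.2 (by linarith [hx.2])).trans_lt hβ⟩
    have hc : ContinuousOn (fun x => G (Real.exp (2 * x))) (Icc α β) :=
      Gcont.comp (by fun_prop) hmaps
    rcases (Icc α β).eq_empty_or_nonempty with he | hne
    · exact ⟨1, one_pos, fun s hs => by simp [he] at hs⟩
    · obtain ⟨x, hx, hmin⟩ := isCompact_Icc.exists_isMinOn hne hc
      exact ⟨_, (hG _ (hmaps x hx)).1, fun s hs =>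
        (hmin hs).trans ((hG _ (hmaps _ hs)).2 _)⟩
  have grow : ∀ c a b, a ≤ b → (∀ s ∈ Icc a b, c ≤ 1 + σ s * Fσ (ϑ s, σ s)) →
      c * (b - a) ≤ l b - l a := by
    intro c a b hab h
    refine (convex_Icc a b).mul_sub_le_image_sub_of_le_deriv lcont.continuousOn
      (fun s _ => (dl s).differentiableAt.differentiableWithinAt) (fun s hs => ?_) a
      (left_mem_Icc.2 hab) b (right_mem_Icc.2 hab) hab
    rw [(dl s).deriv]
    exact h s (interior_subset hs)
  have hlow : ∃ s₁, σ s₁ < σ₀ / 3 := by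
    by_contra! hcon
    have hexp : Real.exp (2 * (Real.log (σ₀ / 3) / 2)) = σ₀ / 3 := by
      rw [mul_div_cancel₀ _ two_ne_zero, Real.exp_log (by positivity)]
    have hge : ∀ s, Real.log (σ₀ / 3) / 2 ≤ l s := fun s => by
      have := hcon s
      rw [← hexp] at this
      linarith [Real.exp_le_exp.1 this]
    obtain ⟨c, hc, hcl⟩ := unif (Real.log (σ₀ / 3) / 2) (l 0) (hlt 0)
    set s := -((l 0 - Real.log (σ₀ / 3) / 2 + 1) / c) with hs
    have hs0 : s ≤ 0 := by
      rw [hs, neg_nonpos]; exact div_nonneg (by linarith [hge 0]) hc.le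
    have h1 := grow c s 0 hs0 fun r hr => hcl r ⟨hge r, lmono.monotone hr.2⟩
    have h2 : c * (0 - s) = l 0 - Real.log (σ₀ / 3) / 2 + 1 := by
      rw [hs]; field_simp; ring
    linarith [hge s]
  obtain ⟨s₁, hs₁⟩ := hlow
  have tσ : Tendsto σ atTop (𝓝 σ₀) := by
    refine tendsto_order.2 ⟨fun a ha => ?_, fun a ha => Eventually.of_forall fun s => (hlt s).trans ha⟩
    by_contra hcon
    have hle : ∀ s, σ s ≤ a := by
      intro s
      by_contra hs
      exact hcon ((eventually_ge_atTop s).mono fun r hr => (not_le.1 hs).trans_le (σmono.monotone hr))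
    have ha0 : 0 < a := (σpos 0).trans_le (hle 0)
    have hexp : Real.exp (2 * (Real.log a / 2)) = a := by
      rw [mul_div_cancel₀ _ two_ne_zero, Real.exp_log ha0]
    have hle' : ∀ s, l s ≤ Real.log a / 2 := fun s => by
      have := hle s
      rw [← hexp] at this
      linarith [Real.exp_le_exp.1 this]
    obtain ⟨c, hc, hcl⟩ := unif (l 0) (Real.log a / 2) (hexp.trans_lt ha)
    set s := (Real.log a / 2 - l 0 + 1) / c with hs
    have hs0 : 0 ≤ s := div_nonneg (by linarith [hle' 0]) hc.le
    have h1 := grow c 0 s hs0 fun r hr => hcl r ⟨lmono.monotone hr.1, hle' r⟩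
    have h2 : c * (s - 0) = Real.log a / 2 - l 0 + 1 := by
      rw [hs]; field_simp; ring
    linarith [hle' s]
  have tϑ : Tendsto ϑ atTop atTop := by
    obtain ⟨σ₁, hσ₁, hbar⟩ := hF.barrier
    obtain ⟨S, hS⟩ := eventually_atTop.1 (tσ.eventually_const_lt hσ₁.2)
    set ψ : ℝ → ℝ := fun s => ϑ s - (σ₀ - σ s)⁻¹ with hψ
    have dψ : ∀ s, HasDerivAt ψ (σ s ^ 2 * Fθ (ϑ s, σ s) / 2 -
        2 * σ s * (1 + σ s * Fσ (ϑ s, σ s)) * ((σ₀ - σ s)⁻¹) ^ 2) s := by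
      intro s
      refine ((dϑ s).sub (((dσ s).const_sub σ₀).fun_inv (sub_pos.2 (hlt s)).ne')).congr_deriv ?_
      simp only [hσ, hl]
      field_simp
    -- The branch of the spiral just behind the trajectory at time `S`. At each later contact with
    -- it `ψ` has positive derivative, so `ψ` never falls below `2πk`.
    set k := ⌊ψ S / (2 * Real.pi)⌋ with hk
    have hkS : (k : ℝ) * (2 * Real.pi) ≤ ψ S := by
      rw [← le_div_iff₀ (by positivity)]; exact Int.floor_le _
    have hge : ∀ s ≥ S, (k : ℝ) * (2 * Real.pi) ≤ ψ s := by
      intro s hs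
      have := image_le_of_deriv_right_lt_deriv_boundary (f := fun s => -ψ s)
        (B := fun _ => -((k : ℝ) * (2 * Real.pi))) (B' := fun _ => 0) (a := S) (b := s)
        (fun r _ => (dψ r).neg.continuousAt.continuousWithinAt)
        (fun r _ => (dψ r).neg.hasDerivWithinAt) (neg_le_neg hkS) (fun r => hasDerivAt_const _ _)
        (fun r hr e => by
          have e' : ψ r = k * (2 * Real.pi) := by linarith
          have := hbar (σ r) ⟨hS r hr.1, hlt r⟩ (ϑ r) k (by rw [← e', hψ]; ring)
          linarith) (right_mem_Icc.2 hs)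
      linarith
    have hinv : Tendsto (fun s => (σ₀ - σ s)⁻¹) atTop atTop := by
      refine tendsto_inv_nhdsGT_zero.comp (tendsto_nhdsWithin_iff.2 ⟨?_,
        Eventually.of_forall fun s => sub_pos.2 (hlt s)⟩)
      simpa using tσ.const_sub σ₀
    refine tendsto_atTop_mono' _ ?_ (tendsto_atTop_add_const_left _ ((k : ℝ) * (2 * Real.pi)) hinv)
    filter_upwards [eventually_ge_atTop S] with s hs
    have := hge s hs
    simp only [hψ] at this
    linarith
  have hconst : ∀ a b, a ≤ b → σ b < σ₀ / 3 → ϑ b = ϑ a ∧ w b - b = w a - a := by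
    intro a b hab hb
    have small : ∀ s ∈ Icc a b, σ s < σ₀ / 3 := fun s hs => (σmono.monotone hs.2).trans_lt hb
    constructor
    · refine constant_of_has_deriv_right_zero (fun s _ => (dϑ s).continuousAt.continuousWithinAt)
        (fun s hs => ?_) b (right_mem_Icc.2 hab)
      refine ((dϑ s).congr_deriv ?_).hasDerivWithinAt
      have := hF.inner_θ (ϑ s) (small s ⟨hs.1, hs.2.le⟩)
      simp only [hσ, hl] at this
      simp [this]
    · have dg : ∀ s, HasDerivAt (fun s : ℝ => w s - s) _ s := fun s =>
        (dw s).sub (Complex.ofRealCLM.hasDerivAt (x := s))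
      refine constant_of_has_deriv_right_zero (f := fun s : ℝ => w s - s)
        (fun s _ => (dg s).continuousAt.continuousWithinAt)
        (fun s hs => ?_) b (right_mem_Icc.2 hab)
      refine ((dg s).congr_deriv ?_).hasDerivWithinAt
      have h1 := hF.inner_θ (ϑ s) (small s ⟨hs.1, hs.2.le⟩)
      have h2 := hF.inner_σ (ϑ s) (small s ⟨hs.1, hs.2.le⟩)
      simp only [hσ, hl] at h1 h2
      simp [h1, h2]
  -- The shift makes the trivial region contain all `s ≤ 1`. In particular it contains `s = 0`, the
  -- value that `Real.log ‖ζ‖` takes at `ζ = 0`.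
  set d := s₁ - 1 with hd
  have hsmall : ∀ s ≤ 1, σ (s + d) < σ₀ / 3 := fun s hs =>
    (σmono.monotone (by linarith)).trans_lt hs₁
  refine ⟨fun s => ϑ (s + d), fun s => w (s + d) - s, fun s => σ (s + d), -d,
    ⟨fun s => ?_, sϑ.comp (by fun_prop), (sw.comp (by fun_prop)).sub Complex.ofRealCLM.contDiff,
      fun s => (dϑ (s + d)).comp_add_const s d, fun s => ?_, hsmall, fun s hs => ?_,
      fun s => hlt _, tσ.comp (tendsto_atTop_add_const_right _ _ tendsto_id),
      tϑ.comp (tendsto_atTop_add_const_right _ _ tendsto_id)⟩, by simp [hϑ0], by simp [hw0]⟩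
  · simp [hσ, hl]
  · refine (((dw (s + d)).comp_add_const s d).sub
      (Complex.ofRealCLM.hasDerivAt (x := s))).congr_deriv ?_
    simp [hσ, hl]
  · have h00 := hsmall 0 zero_le_one
    rcases le_total s 0 with h | h
    · obtain ⟨h1, h2⟩ := hconst (s + d) (0 + d) (by linarith) h00
      refine ⟨h1.symm, ?_⟩
      push_cast at h2 ⊢
      linear_combination -h2
    · obtain ⟨h1, h2⟩ := hconst (0 + d) (s + d) (by linarith) hs
      refine ⟨h1, ?_⟩
      push_cast at h2 ⊢
      linear_combination h2

/-! ### The exterior derivative and the Reeb field of `e^f λ₀` -/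

theorem coverProj_add {n : ℕ} (x y : CoverSpace n) :
    coverProj x + coverProj y = coverProj (x + y) := by
  simp [coverProj]

theorem coverProj_surjective {n : ℕ} : Function.Surjective (coverProj (n := n)) := by
  rintro ⟨θ, z⟩
  obtain ⟨t, rfl⟩ := QuotientAddGroup.mk_surjective θ
  exact ⟨(t, z), rfl⟩

theorem extDerivOne_eq_apply {X : Type*} [NormedAddCommGroup X] [NormedSpace ℝ X]
    {η : X → X →L[ℝ] ℝ} {x : X} (hη : DifferentiableAt ℝ η x) {v w : X} {a b : X →L[ℝ] ℝ}
    (ha : HasFDerivAt (fun y => η y w) a x) (hb : HasFDerivAt (fun y => η y v) b x) :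
    extDerivOne η x v w = a v - b w := by
  have h : ∀ u, HasFDerivAt (fun y => η y u) ((fderiv ℝ η x).flip u) x := fun u =>
    hη.hasFDerivAt.clm_apply (hasFDerivAt_const u x) |>.congr_fderiv (by ext; simp)
  rw [extDerivOne_eq, ha.unique (h w), hb.unique (h v)]
  simp

/-- The standard pairing `∑ᵢ Im(z̄ᵢ wᵢ)` on `ℂⁿ`. -/
def imPairing {n : ℕ} (z w : Fin n → ℂ) : ℝ := ∑ i, ((z i).re * (w i).im - (z i).im * (w i).re)

theorem lamZero_eq {n : ℕ} (p : CircleSpace n) (v : CoverSpace n) :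
    lamZero n p v = v.1 + imPairing p.2 v.2 := lamZero_apply p v

/-- `z ↦ imPairing z w` as a continuous linear map. -/
def imPairingLeft {n : ℕ} (w : Fin n → ℂ) : CoverSpace n →L[ℝ] ℝ :=
  ∑ i : Fin n, ((w i).im • (Complex.reCLM ∘L ContinuousLinearMap.proj (R := ℝ) i ∘L
          ContinuousLinearMap.snd ℝ ℝ (Fin n → ℂ)) -
        (w i).re • (Complex.imCLM ∘L ContinuousLinearMap.proj (R := ℝ) i ∘L
          ContinuousLinearMap.snd ℝ ℝ (Fin n → ℂ)))

theorem imPairingLeft_apply {n : ℕ} (w : Fin n → ℂ) (x : CoverSpace n) :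
    imPairingLeft w x = imPairing x.2 w := by
  simp [imPairingLeft, imPairing, mul_comm]

theorem imPairing_swap {n : ℕ} (z w : Fin n → ℂ) : imPairing z w = -imPairing w z := by
  simp only [imPairing, ← Finset.sum_neg_distrib]
  exact Finset.sum_congr rfl fun i _ => by ring

theorem imPairing_add_left {n : ℕ} (z z' w : Fin n → ℂ) :
    imPairing (z + z') w = imPairing z w + imPairing z' w := by
  simp only [imPairing, ← Finset.sum_add_distrib]
  exact Finset.sum_congr rfl fun i _ => by simp; ring

theorem imPairing_smul_left {n : ℕ} (c : ℝ) (z w : Fin n → ℂ) :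
    imPairing (c • z) w = c * imPairing z w := by
  simp only [imPairing, Finset.mul_sum]
  exact Finset.sum_congr rfl fun i _ => by simp; ring

theorem imPairing_self {n : ℕ} (z : Fin n → ℂ) : imPairing z z = 0 := by
  have := imPairing_swap z z
  linarith

theorem imPairing_single_left {n : ℕ} (i : Fin n) (a : ℂ) (w : Fin n → ℂ) :
    imPairing (Pi.single i a) w = a.re * (w i).im - a.im * (w i).re := by
  rw [imPairing, Finset.sum_eq_single i]
  · simp
  · intro j _ hj; simp [hj]
  · simp

theorem differentiable_lamZero {n : ℕ} (p : CircleSpace n) :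
    Differentiable ℝ fun x : CoverSpace n => lamZero n (p + coverProj x) := by
  have h : ∀ x : CoverSpace n, (p + coverProj x).2 = p.2 + x.2 := fun x => rfl
  simp only [lamZero, h, Pi.add_apply, Complex.add_re, Complex.add_im]
  have hre : ∀ i, Differentiable ℝ fun x : CoverSpace n => (x.2 i).re := fun i =>
    Complex.reCLM.differentiable.comp (by fun_prop)
  have him : ∀ i, Differentiable ℝ fun x : CoverSpace n => (x.2 i).im := fun i =>
    Complex.imCLM.differentiable.comp (by fun_prop)
  fun_prop

theorem hasFDerivAt_lamZero_apply {n : ℕ} (p : CircleSpace n) (v : CoverSpace n) :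
    HasFDerivAt (fun x : CoverSpace n => lamZero n (p + coverProj x) v) (imPairingLeft v.2) 0 := by
  have : (fun x : CoverSpace n => lamZero n (p + coverProj x) v) =
      fun x => lamZero n p v + imPairingLeft v.2 x := by
    ext x
    have h : (p + coverProj x).2 = p.2 + x.2 := rfl
    rw [lamZero_eq, lamZero_eq, h, imPairing_add_left, imPairingLeft_apply]; ring
  rw [this]
  exact (imPairingLeft v.2).hasFDerivAt.const_add _

theorem d_lamZero {n : ℕ} (p : CircleSpace n) (v w : CoverSpace n) :
    (lamZero n).d p v w = 2 * imPairing v.2 w.2 := by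
  rw [CircleSpaceForm.d, extDerivOne_eq_apply (differentiable_lamZero p 0)
    (hasFDerivAt_lamZero_apply p w) (hasFDerivAt_lamZero_apply p v), imPairingLeft_apply,
    imPairingLeft_apply, imPairing_swap w.2]
  ring

theorem d_expMulForm {n : ℕ} {f : CircleSpace n → ℝ} {p : CircleSpace n} {f' : CoverSpace n →L[ℝ] ℝ}
    (hf : HasFDerivAt (fun x : CoverSpace n => f (p + coverProj x)) f' 0) (v w : CoverSpace n) :
    (expMulForm f (lamZero n)).d p v w = Real.exp (f p) *
      (f' v * lamZero n p w - f' w * lamZero n p v + 2 * imPairing v.2 w.2) := by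
  have hp : p + coverProj (0 : CoverSpace n) = p := by simp [coverProj]
  have h : ∀ v, HasFDerivAt (fun x : CoverSpace n => expMulForm f (lamZero n) (p + coverProj x) v)
      (Real.exp (f p) • imPairingLeft v.2 + lamZero n p v • Real.exp (f p) • f') 0 := fun v => by
    have := hf.exp.mul (hasFDerivAt_lamZero_apply p v)
    rwa [hp] at this
  have hd : DifferentiableAt ℝ
      (fun x : CoverSpace n => expMulForm f (lamZero n) (p + coverProj x)) 0 :=
    hf.exp.differentiableAt.smul (differentiable_lamZero p 0)
  rw [CircleSpaceForm.d, extDerivOne_eq_apply hd (h w) (h v)]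
  simp only [add_apply, smul_apply, imPairingLeft_apply, smul_eq_mul]
  rw [imPairing_swap w.2]
  ring

/-- The function on `S¹ × ℝ²ⁿ` given by a function of `θ` that is `2π`-periodic, and of the square
`σ` of the norm of the last coordinate. -/
def circleFun {m : ℕ} (G : ℝ × ℝ → ℝ) (p : CircleSpace (m + 1)) : ℝ :=
  G (Quotient.out p.1, Complex.normSq (p.2 (Fin.last m)))

theorem circleFun_coverProj {m : ℕ} {G : ℝ × ℝ → ℝ}
    (hG : ∀ t σ, G (t + 2 * Real.pi, σ) = G (t, σ)) (x : CoverSpace (m + 1)) :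
    circleFun G (coverProj x) = G (x.1, Complex.normSq (x.2 (Fin.last m))) := by
  have hper : Function.Periodic (fun t => G (t, Complex.normSq (x.2 (Fin.last m)))) (2 * Real.pi) :=
    fun t => hG t _
  have h : ((Quotient.out (coverProj x).1 : ℝ) : AddCircle (2 * Real.pi)) = (x.1 : ℝ) :=
    Quotient.out_eq _
  rw [← sub_eq_zero, ← AddCircle.coe_sub, AddCircle.coe_eq_zero_iff] at h
  obtain ⟨k, hk⟩ := h
  have hk' : (Quotient.out (coverProj x).1 : ℝ) = x.1 + k * (2 * Real.pi) := by
    rw [zsmul_eq_mul] at hk; linarith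
  change G (Quotient.out (coverProj x).1, _) = _
  rw [hk']
  exact hper.int_mul k x.1

theorem contDiff_normSq_last {m : ℕ} :
    ContDiff ℝ ∞ fun x : CoverSpace (m + 1) => Complex.normSq (x.2 (Fin.last m)) := by
  have hz : ContDiff ℝ ∞ fun x : CoverSpace (m + 1) => x.2 (Fin.last m) := by fun_prop
  simp only [Complex.normSq_apply]
  have h1 := Complex.reCLM.contDiff.comp hz
  have h2 := Complex.imCLM.contDiff.comp hz
  exact (h1.mul h1).add (h2.mul h2)

theorem smooth_circleFun {m : ℕ} {G : ℝ × ℝ → ℝ}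
    (hG : ∀ t σ, G (t + 2 * Real.pi, σ) = G (t, σ)) (hs : ContDiff ℝ ∞ G) :
    SmoothOnCircleSpace (n := m + 1) (circleFun G) := by
  unfold SmoothOnCircleSpace
  simp only [circleFun_coverProj hG]
  exact hs.comp (contDiff_fst.prodMk contDiff_normSq_last)

/-- The Reeb vector field of `e^F λ₀`, for `F` a function of `θ` and `σ = |z|²`, with `z` the last
coordinate. -/
def reebField {m : ℕ} (F Fθ Fσ : ℝ × ℝ → ℝ) (p : CircleSpace (m + 1)) : CoverSpace (m + 1) :=
  Real.exp (-circleFun F p) • (1 + Complex.normSq (p.2 (Fin.last m)) * circleFun Fσ p,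
    (-(circleFun Fθ p / 2)) • p.2 +
      (-circleFun Fσ p) • (Pi.single (Fin.last m) (Complex.I * p.2 (Fin.last m)) :
        Fin (m + 1) → ℂ))

/-- The last coordinate, as a linear map on tangent vectors. -/
def lastCoord (m : ℕ) : CoverSpace (m + 1) →L[ℝ] ℂ :=
  ContinuousLinearMap.proj (R := ℝ) (Fin.last m) ∘L ContinuousLinearMap.snd ℝ ℝ (Fin (m + 1) → ℂ)

@[simp] theorem lastCoord_apply {m : ℕ} (v : CoverSpace (m + 1)) :
    lastCoord m v = v.2 (Fin.last m) := rfl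

theorem SpiralProfile.hasFDerivAt_circleFun {σ₀ : ℝ} {F Fθ Fσ : ℝ × ℝ → ℝ}
    (hF : SpiralProfile σ₀ F Fθ Fσ) {m : ℕ} (p : CircleSpace (m + 1)) :
    HasFDerivAt (fun y : CoverSpace (m + 1) => circleFun F (p + coverProj y))
      (circleFun Fθ p • ContinuousLinearMap.fst ℝ ℝ (Fin (m + 1) → ℂ) + (2 * circleFun Fσ p) •
        ((p.2 (Fin.last m)).re • Complex.reCLM ∘L lastCoord m +
          (p.2 (Fin.last m)).im • Complex.imCLM ∘L lastCoord m)) 0 := by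
  obtain ⟨x, rfl⟩ := coverProj_surjective p
  have hz : HasFDerivAt (fun y => lastCoord m x + lastCoord m y) (lastCoord m) 0 :=
    (lastCoord m).hasFDerivAt.const_add _
  have hre := Complex.reCLM.hasFDerivAt.comp (0 : CoverSpace (m + 1)) hz
  have him := Complex.imCLM.hasFDerivAt.comp (0 : CoverSpace (m + 1)) hz
  have ht : HasFDerivAt (fun y : CoverSpace (m + 1) => x.1 + y.1)
      (ContinuousLinearMap.fst ℝ ℝ (Fin (m + 1) → ℂ)) 0 :=
    (ContinuousLinearMap.fst ℝ ℝ (Fin (m + 1) → ℂ)).hasFDerivAt.const_add x.1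
  have hf := (hF.hasFDerivAt _).comp (0 : CoverSpace (m + 1))
    (ht.prodMk ((hre.mul hre).add (him.mul him)))
  refine (hf.congr_of_eventuallyEq (Eventually.of_forall fun y => ?_)).congr_fderiv ?_
  · rw [coverProj_add, circleFun_coverProj hF.periodic, Complex.normSq_apply]
    rfl
  · rw [circleFun_coverProj hF.periodic_θ, circleFun_coverProj hF.periodic_σ, Complex.normSq_apply]
    have hx : (coverProj x).2 = x.2 := rfl
    refine ContinuousLinearMap.ext fun v => ?_
    simp [hx]
    ring

/-- Under `dλ₀ = 2 ∑ dxᵢ ∧ dyᵢ`, the radial term accounts for `F_θ` and the rotational term for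
`F_σ`. The `∂_θ` component then makes `λ₀(X) = e^{-F}`. -/
theorem SpiralProfile.isReebField {σ₀ : ℝ} {F Fθ Fσ : ℝ × ℝ → ℝ}
    (hF : SpiralProfile σ₀ F Fθ Fσ) (m : ℕ) :
    IsReebField (expMulForm (circleFun F) (lamZero (m + 1))) (reebField F Fθ Fσ) := by
  intro p
  obtain ⟨x, rfl⟩ := coverProj_surjective p
  set p := coverProj x with hp
  set z := p.2 (Fin.last m) with hz
  have hlam : lamZero (m + 1) p (reebField F Fθ Fσ p) = Real.exp (-circleFun F p) := by
    rw [reebField, map_smul, lamZero_eq, imPairing_swap, imPairing_add_left, imPairing_smul_left,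
      imPairing_smul_left, imPairing_self, imPairing_single_left]
    simp [← hz, Complex.normSq_apply]
    ring
  have hexp : Real.exp (circleFun F p) * Real.exp (-circleFun F p) = 1 := by
    rw [← Real.exp_add, add_neg_cancel, Real.exp_zero]
  refine ⟨?_, fun v => ?_⟩
  · rw [expMulForm, smul_apply, hlam, smul_eq_mul, hexp]
  · rw [d_expMulForm (hF.hasFDerivAt_circleFun p), hlam, lamZero_eq]
    simp only [reebField, Prod.smul_mk, imPairing_smul_left, imPairing_add_left,
      imPairing_single_left, ← hz, Complex.normSq_apply]
    generalize Real.exp (-circleFun F p) = e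
    simp [← hz]
    ring

/-! ### The complex structure -/

/-- The complex structure on `ker λ₀` that is multiplication by `√-1` in the projection to `ℂⁿ`. -/
def stdJ (n : ℕ) (p : CircleSpace n) : CoverSpace n →L[ℝ] CoverSpace n :=
  ContinuousLinearMap.inl ℝ ℝ (Fin n → ℂ) ∘L (-∑ i : Fin n,
      ((p.2 i).re • (Complex.reCLM ∘L ContinuousLinearMap.proj (R := ℝ) i ∘L
          ContinuousLinearMap.snd ℝ ℝ (Fin n → ℂ)) +
        (p.2 i).im • (Complex.imCLM ∘L ContinuousLinearMap.proj (R := ℝ) i ∘L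
          ContinuousLinearMap.snd ℝ ℝ (Fin n → ℂ)))) +
    ContinuousLinearMap.inr ℝ ℝ (Fin n → ℂ) ∘L
      (Complex.I • ContinuousLinearMap.snd ℝ ℝ (Fin n → ℂ))

theorem stdJ_apply {n : ℕ} (p : CircleSpace n) (v : CoverSpace n) :
    stdJ n p v = (-imPairing p.2 (Complex.I • v.2), Complex.I • v.2) := by
  ext
  · simp [stdJ, imPairing, Prod.fst_sum]
  · simp [stdJ, Prod.snd_sum]

/-- The projection of `ker λ₀` to `ℂⁿ` is an isomorphism that carries `J` to multiplication by `√-1`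
and `dλ₀` to twice the standard symplectic form. -/
theorem isCompatibleJ_stdJ (n : ℕ) : IsCompatibleJ (lamZero n) (stdJ n) where
  smooth := by
    unfold SmoothOnCircleSpace stdJ
    have h : ∀ x : CoverSpace n, (coverProj x).2 = x.2 := fun x => rfl
    simp only [h]
    have hre : ∀ i, ContDiff ℝ ∞ fun x : CoverSpace n => (x.2 i).re := fun i =>
      Complex.reCLM.contDiff.comp (by fun_prop)
    have him : ∀ i, ContDiff ℝ ∞ fun x : CoverSpace n => (x.2 i).im := fun i =>
      Complex.imCLM.contDiff.comp (by fun_prop)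
    refine ContDiff.add (contDiff_const.clm_comp (ContDiff.neg (ContDiff.sum fun i _ => ?_)))
      contDiff_const
    exact ((hre i).smul contDiff_const).add ((him i).smul contDiff_const)
  mapsTo p v _ := by rw [lamZero_eq, stdJ_apply]; simp
  sq p v hv := by
    rw [lamZero_eq] at hv
    have h : Complex.I • Complex.I • v.2 = -v.2 := by
      rw [smul_smul, Complex.I_mul_I, neg_one_smul]
    have h' : imPairing p.2 (-v.2) = -imPairing p.2 v.2 := by
      rw [imPairing_swap, ← neg_one_smul ℝ v.2, imPairing_smul_left, imPairing_swap p.2 v.2]; ring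
    rw [stdJ_apply, stdJ_apply]
    simp only [h, h']
    ext
    · simp; linarith
    · simp
  symm p v w _ _ := by
    rw [d_lamZero, d_lamZero, stdJ_apply, stdJ_apply, imPairing, imPairing]
    congr 1
    exact Finset.sum_congr rfl fun i _ => by simp; ring
  pos p v hv hne := by
    rw [d_lamZero, stdJ_apply, imPairing]
    refine mul_pos two_pos ?_
    have hsum : ∀ i, (v.2 i).re * ((Complex.I • v.2) i).im - (v.2 i).im * ((Complex.I • v.2) i).re =
        Complex.normSq (v.2 i) := fun i => by simp [Complex.normSq_apply]
    simp only [hsum]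
    refine Finset.sum_pos' (fun i _ => Complex.normSq_nonneg _) ?_
    by_contra! hcon
    have hz : v.2 = 0 := funext fun i =>
      Complex.normSq_eq_zero.1 (le_antisymm (hcon i (Finset.mem_univ i)) (Complex.normSq_nonneg _))
    refine hne (Prod.ext ?_ hz)
    rw [lamZero_eq, hz] at hv
    simpa [imPairing] using hv

/-! ### Radial functions on the plane -/

/-- The differential of `log |ζ|` at `ζ ≠ 0`. -/
def dlog (ζ : ℂ) : ℂ →L[ℝ] ℝ :=
  (Complex.normSq ζ)⁻¹ • (ζ.re • Complex.reCLM + ζ.im • Complex.imCLM)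

/-- The angular form at `ζ ≠ 0`. -/
def dang (ζ : ℂ) : ℂ →L[ℝ] ℝ :=
  (Complex.normSq ζ)⁻¹ • (ζ.re • Complex.imCLM - ζ.im • Complex.reCLM)

theorem dlog_apply (ζ w : ℂ) :
    dlog ζ w = (Complex.normSq ζ)⁻¹ * (ζ.re * w.re + ζ.im * w.im) := by simp [dlog, mul_add]

theorem dang_apply (ζ w : ℂ) :
    dang ζ w = (Complex.normSq ζ)⁻¹ * (ζ.re * w.im - ζ.im * w.re) := by simp [dang]

theorem dlog_I_mul (ζ w : ℂ) : dlog ζ (Complex.I * w) = -dang ζ w := by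
  simp [dlog_apply, dang_apply]; ring

theorem dang_I_mul (ζ w : ℂ) : dang ζ (Complex.I * w) = dlog ζ w := by
  simp [dlog_apply, dang_apply]

theorem mul_dlog_add_dang {ζ : ℂ} (hζ : ζ ≠ 0) (w : ℂ) :
    ζ * (dlog ζ w + Complex.I * dang ζ w) = w := by
  have h : (Complex.normSq ζ)⁻¹ * (ζ.re * ζ.re + ζ.im * ζ.im) = 1 := by
    rw [← Complex.normSq_apply]
    exact inv_mul_cancel₀ (by simpa using hζ)
  rw [dlog_apply, dang_apply]
  generalize (Complex.normSq ζ)⁻¹ = N at h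
  apply Complex.ext
  · simp
    linear_combination w.re * h
  · simp
    linear_combination w.im * h

theorem log_norm_eq (ζ : ℂ) : Real.log ‖ζ‖ = Real.log (ζ.re * ζ.re + ζ.im * ζ.im) / 2 := by
  rw [← Complex.normSq_apply, Complex.normSq_eq_norm_sq, Real.log_pow]
  push_cast; ring

theorem hasFDerivAt_log_norm {ζ : ℂ} (hζ : ζ ≠ 0) :
    HasFDerivAt (fun ζ : ℂ => Real.log ‖ζ‖) (dlog ζ) ζ := by
  have h : Complex.normSq ζ ≠ 0 := by simpa using hζ
  have hre := Complex.reCLM.hasFDerivAt (x := ζ)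
  have him := Complex.imCLM.hasFDerivAt (x := ζ)
  have := (((hre.mul hre).add (him.mul him)).log
    (by simpa [Complex.normSq_apply] using h)).mul_const (2⁻¹ : ℝ)
  refine (this.congr_of_eventuallyEq (Eventually.of_forall fun y => ?_)).congr_fderiv ?_
  · simp [log_norm_eq, div_eq_mul_inv]
  · refine ContinuousLinearMap.ext fun w => ?_
    simp [dlog_apply, Complex.normSq_apply]
    ring

theorem hasFDerivAt_radial {E : Type*} [NormedAddCommGroup E] [NormedSpace ℝ E] {f : ℝ → E} {f' : E}
    {ζ : ℂ} (hζ : ζ ≠ 0) (hf : HasDerivAt f f' (Real.log ‖ζ‖)) :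
    HasFDerivAt (fun ζ : ℂ => f (Real.log ‖ζ‖)) ((dlog ζ).smulRight f') ζ :=
  (hf.hasFDerivAt.comp ζ (hasFDerivAt_log_norm hζ)).congr_fderiv (by ext; simp)

theorem log_norm_le_one_eventually : ∀ᶠ ζ : ℂ in 𝓝 0, Real.log ‖ζ‖ ≤ 1 := by
  filter_upwards [Metric.ball_mem_nhds (0 : ℂ) one_pos] with ζ hζ
  rw [mem_ball_zero_iff] at hζ
  linarith [Real.log_nonpos (norm_nonneg ζ) hζ.le]

/-- Since `Real.log 0 = 0 ≤ 1`, the function is constant on a full neighbourhood of the origin, the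
origin included. -/
theorem contDiff_radial {E : Type*} [NormedAddCommGroup E] [NormedSpace ℝ E] {f : ℝ → E}
    (hf : ContDiff ℝ ∞ f) (hc : ∀ s ≤ 1, f s = f 0) :
    ContDiff ℝ ∞ fun ζ : ℂ => f (Real.log ‖ζ‖) := by
  rw [contDiff_iff_contDiffAt]
  intro ζ
  rcases eq_or_ne ζ 0 with rfl | hζ
  · refine (contDiffAt_const (c := f 0)).congr_of_eventuallyEq ?_
    filter_upwards [log_norm_le_one_eventually] with ζ hζ using hc _ hζ
  · exact hf.contDiffAt.comp ζ ((contDiffAt_norm ℝ hζ).log (norm_ne_zero_iff.2 hζ))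

/-- The exterior derivative of `G(log |ζ|) dt`, where `dt` is the angular form. -/
theorem extDerivOne_radial {G : ℝ → ℝ} {G' : ℝ} {ζ : ℂ} (hζ : ζ ≠ 0)
    (hG : HasDerivAt G G' (Real.log ‖ζ‖)) {η : ℂ → ℂ →L[ℝ] ℝ}
    (hη : η =ᶠ[𝓝 ζ] fun ζ => G (Real.log ‖ζ‖) • dang ζ) :
    extDerivOne η ζ 1 Complex.I = G' / ‖ζ‖ ^ 2 := by
  have h : Complex.normSq ζ ≠ 0 := by simpa using hζ
  have hre := Complex.reCLM.hasFDerivAt (x := ζ)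
  have him := Complex.imCLM.hasFDerivAt (x := ζ)
  have hn := (hre.mul hre).add (him.mul him)
  have hd : ∀ w, HasFDerivAt (fun ζ : ℂ => η ζ w) _ ζ := fun w =>
    ((hasFDerivAt_radial hζ hG).mul
      ((((hasDerivAt_inv (by simpa [Complex.normSq_apply] using h)).comp_hasFDerivAt ζ hn).mul
        ((hre.mul_const w.im).sub (him.mul_const w.re))))).congr_of_eventuallyEq (by
      filter_upwards [hη] with y hy
      simp [hy, dang_apply, Complex.normSq_apply])
  have hdiff : DifferentiableAt ℝ η ζ := by
    refine DifferentiableAt.congr_of_eventuallyEq ?_ hη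
    refine (hasFDerivAt_radial hζ hG).differentiableAt.smul ?_
    have e : dang = fun ζ : ℂ => (Complex.reCLM ζ * Complex.reCLM ζ +
        Complex.imCLM ζ * Complex.imCLM ζ)⁻¹ •
        (Complex.reCLM ζ • Complex.imCLM - Complex.imCLM ζ • Complex.reCLM) := by
      ext ζ; simp [dang, Complex.normSq_apply]
    rw [e]
    exact (hn.differentiableAt.inv (by simpa [Complex.normSq_apply] using h)).smul
      ((hre.differentiableAt.smul_const _).sub (him.differentiableAt.smul_const _))
  rw [extDerivOne_eq_apply hdiff (hd Complex.I) (hd 1), ← Complex.normSq_eq_norm_sq]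
  have h' : (ζ.re * ζ.re + ζ.im * ζ.im) ≠ 0 := by rwa [Complex.normSq_apply] at h
  simp [dlog_apply, Complex.normSq_apply]
  generalize hN : ζ.re * ζ.re + ζ.im * ζ.im = N at h' ⊢
  have hi := inv_mul_cancel₀ h'
  rw [div_eq_mul_inv, ← inv_pow]
  linear_combination (G' - 2 * G (Real.log ‖ζ‖)) * N⁻¹ ^ 2 * hN +
    (G' - 2 * G (Real.log ‖ζ‖)) * N⁻¹ * hi

/-- The area integral of a radial exact form on the plane. -/
theorem lintegral_radial_le {G G' : ℝ → ℝ} {C : ℝ} (hG : ∀ s, HasDerivAt G (G' s) s)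
    (hc : Continuous G') (h0 : ∀ s, 0 ≤ G' s) (hG0 : ∀ s, 0 ≤ G s) (hGC : ∀ s, G s ≤ C) :
    ∫⁻ ζ : ℂ, ENNReal.ofReal (G' (Real.log ‖ζ‖) / ‖ζ‖ ^ 2) ≤
      ENNReal.ofReal C * ENNReal.ofReal (2 * Real.pi) := by
  rw [← Complex.lintegral_comp_polarCoord_symm]
  -- The polar Jacobian turns `r⁻²` into `r⁻¹`, leaving `dr / r = ds`. Below, the half-line is
  -- exhausted by `(e^{-n}, e^n]`, where the integral is `G(n) - G(-n)`.
  have e : ∀ p ∈ polarCoord.target, ENNReal.ofReal p.1 •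
      ENNReal.ofReal (G' (Real.log ‖Complex.polarCoord.symm p‖) / ‖Complex.polarCoord.symm p‖ ^ 2) =
      ENNReal.ofReal (G' (Real.log p.1) * p.1⁻¹) * 1 := by
    rintro ⟨r, t⟩ hp
    have hr : 0 < r := by simpa using hp.1
    rw [Complex.norm_polarCoord_symm, abs_of_pos hr, smul_eq_mul, ← ENNReal.ofReal_mul hr.le, mul_one]
    congr 1
    field_simp
  rw [setLIntegral_congr_fun polarCoord.open_target.measurableSet e, polarCoord_target,
    Measure.volume_eq_prod, ← Measure.prod_restrict]
  have hmeas : Measurable fun r : ℝ => ENNReal.ofReal (G' (Real.log r) * r⁻¹) :=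
    ((hc.measurable.comp Real.measurable_log).mul measurable_inv).ennreal_ofReal
  rw [lintegral_prod_mul hmeas.aemeasurable aemeasurable_const]
  have hangle : ∫⁻ _ in Ioo (-Real.pi) Real.pi, (1 : ℝ≥0∞) = ENNReal.ofReal (2 * Real.pi) := by
    simp [two_mul]
  rw [hangle]
  gcongr
  have hU : Ioi (0 : ℝ) = ⋃ n : ℕ, Ioc (Real.exp (-n)) (Real.exp n) := by
    ext r
    simp only [mem_Ioi, mem_iUnion, mem_Ioc]
    refine ⟨fun hr => ?_, fun ⟨n, hn, _⟩ => (Real.exp_pos _).trans hn⟩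
    obtain ⟨n, hn⟩ := exists_nat_gt |Real.log r|
    refine ⟨n, ?_, ?_⟩
    · rw [← Real.lt_log_iff_exp_lt hr]; linarith [neg_abs_le (Real.log r)]
    · rw [← Real.log_le_iff_le_exp hr]; linarith [le_abs_self (Real.log r)]
  have hdir : Directed (· ⊆ ·) fun n : ℕ => Ioc (Real.exp (-n)) (Real.exp n) := by
    refine Monotone.directed_le fun a b hab => Ioc_subset_Ioc ?_ ?_ <;> gcongr
  rw [hU, setLIntegral_iUnion_of_directed _ hdir]
  refine iSup_le fun n => ?_
  have hle : Real.exp (-n : ℝ) ≤ Real.exp n := Real.exp_le_exp.2 (by linarith [n.cast_nonneg (α := ℝ)])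
  have hpos : ∀ r ∈ Icc (Real.exp (-n : ℝ)) (Real.exp n), 0 < r := fun r hr =>
    (Real.exp_pos _).trans_le hr.1
  have hcont : ContinuousOn (fun r => G' (Real.log r) * r⁻¹) (Icc (Real.exp (-n : ℝ)) (Real.exp n)) :=
    (hc.comp_continuousOn (Real.continuousOn_log.mono fun r hr => (hpos r hr).ne')).mul
      (continuousOn_inv₀.mono fun r hr => (hpos r hr).ne')
  have hint : IntegrableOn (fun r => G' (Real.log r) * r⁻¹)
      (Ioc (Real.exp (-n : ℝ)) (Real.exp n)) :=
    hcont.integrableOn_Icc.mono_set Ioc_subset_Icc_self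
  rw [← ofReal_integral_eq_lintegral_ofReal hint ((ae_restrict_iff' measurableSet_Ioc).2
    (Eventually.of_forall fun r hr => mul_nonneg (h0 _)
      (inv_nonneg.2 (hpos r (Ioc_subset_Icc_self hr)).le))),
    ← intervalIntegral.integral_of_le hle]
  refine ENNReal.ofReal_le_ofReal ?_
  rw [intervalIntegral.integral_eq_sub_of_hasDerivAt (f := fun r => G (Real.log r))
    (fun r hr => (hG _).comp r (Real.hasDerivAt_log (hpos r (by rwa [uIcc_of_le hle] at hr)).ne'))
    (hcont.intervalIntegrable_of_Icc hle)]
  linarith [hGC (Real.log (Real.exp n)), hG0 (Real.log (Real.exp (-n)))]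

/-! ### The planes -/

/-- The plane over a trajectory, in the universal cover. -/
def spiralPlane (m : ℕ) (ϑ : ℝ → ℝ) (g : ℝ → ℂ) (ζ : ℂ) : CoverSpace (m + 1) :=
  (ϑ (Real.log ‖ζ‖), Pi.single (Fin.last m) (ζ * Complex.exp (g (Real.log ‖ζ‖))))

/-- The `ℝ`-component of the plane over a trajectory with `a' = H`, which is `c e^{2s}` for
`s ≤ 1`. -/
def spiralHeight (c : ℝ) (H : ℝ → ℝ) (ζ : ℂ) : ℝ :=
  c / 2 * ‖ζ‖ ^ 2 + ∫ r in 0..Real.log ‖ζ‖, (H r - c * Real.exp (2 * r))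

theorem exp_two_mul_log_norm {ζ : ℂ} (hζ : ζ ≠ 0) : Real.exp (2 * Real.log ‖ζ‖) = ‖ζ‖ ^ 2 := by
  rw [mul_comm, Real.exp_mul, Real.exp_log (norm_pos_iff.2 hζ)]
  norm_cast

theorem contDiff_integral {h : ℝ → ℝ} (hh : ContDiff ℝ ∞ h) :
    ContDiff ℝ ∞ fun s => ∫ r in 0..s, h r := by
  have hd : ∀ s, HasDerivAt (fun s => ∫ r in 0..s, h r) (h s) s := fun s =>
    (hh.continuous.integral_hasStrictDerivAt 0 s).hasDerivAt
  refine contDiff_infty_iff_deriv.2 ⟨fun s => (hd s).differentiableAt, ?_⟩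
  rwa [show deriv (fun s => ∫ r in 0..s, h r) = h from funext fun s => (hd s).deriv]

/-! ### The height function of a radial plane -/

section Height

variable {c : ℝ} {H : ℝ → ℝ}

/-- The quadratic term carries the part `c e^{2s}` of `H` smoothly through the origin, and the
remaining integral vanishes for `s ≤ 1`. -/
theorem contDiff_spiralHeight (hH : ContDiff ℝ ∞ H) (hc : ∀ s ≤ 1, H s = c * Real.exp (2 * s)) :
    ContDiff ℝ ∞ (spiralHeight c H) := by
  have h1 : ContDiff ℝ ∞ fun r => H r - c * Real.exp (2 * r) := hH.sub (by fun_prop)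
  refine (contDiff_const.mul (contDiff_norm_sq ℝ)).add
    (contDiff_radial (contDiff_integral h1) fun s hs => ?_)
  rw [intervalIntegral.integral_same]
  refine (intervalIntegral.integral_congr (g := fun _ => 0) fun r hr => ?_).trans (by simp)
  have hr1 : r ≤ 1 := hr.2.trans (max_le zero_le_one hs)
  simp [hc r hr1]

/-- The antiderivative of `H` that gives `spiralHeight` in terms of `s = log |ζ|`. -/
def radialHeight (c : ℝ) (H : ℝ → ℝ) (s : ℝ) : ℝ :=
  c / 2 * Real.exp (2 * s) + ∫ r in 0..s, (H r - c * Real.exp (2 * r))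

theorem spiralHeight_eq {ζ : ℂ} (hζ : ζ ≠ 0) :
    spiralHeight c H ζ = radialHeight c H (Real.log ‖ζ‖) := by
  rw [spiralHeight, radialHeight, exp_two_mul_log_norm hζ]

theorem hasDerivAt_radialHeight (hH : Continuous H) (s : ℝ) :
    HasDerivAt (radialHeight c H) (H s) s := by
  have h1 : Continuous fun r => H r - c * Real.exp (2 * r) := hH.sub (by fun_prop)
  have h2 := (((hasDerivAt_id s).const_mul 2).exp.const_mul (c / 2)).add
    (h1.integral_hasStrictDerivAt 0 s).hasDerivAt
  refine h2.congr_deriv ?_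
  simp; ring

theorem hasFDerivAt_spiralHeight (hH : Continuous H) {ζ : ℂ} (hζ : ζ ≠ 0) :
    HasFDerivAt (spiralHeight c H) (H (Real.log ‖ζ‖) • dlog ζ) ζ := by
  refine ((hasFDerivAt_radial hζ (hasDerivAt_radialHeight (c := c) hH _)).congr_of_eventuallyEq
    ?_).congr_fderiv ?_
  · filter_upwards [isOpen_ne.mem_nhds hζ] with y hy using spiralHeight_eq hy
  · ext
    simp [mul_comm]

theorem hasFDerivAt_spiralHeight_zero (hc : ∀ s ≤ 1, H s = c * Real.exp (2 * s)) :
    HasFDerivAt (spiralHeight c H) (0 : ℂ →L[ℝ] ℝ) 0 := by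
  have h1 : HasFDerivAt (fun ζ : ℂ => c / 2 * ‖ζ‖ ^ 2) (0 : ℂ →L[ℝ] ℝ) 0 := by
    refine ((hasStrictFDerivAt_norm_sq (0 : ℂ)).hasFDerivAt.const_mul (c / 2)).congr_fderiv ?_
    ext
    simp
  refine h1.congr_of_eventuallyEq ?_
  filter_upwards [log_norm_le_one_eventually] with ζ hζ
  rw [spiralHeight, add_eq_left]
  refine (intervalIntegral.integral_congr (g := fun _ => 0) fun r hr => ?_).trans (by simp)
  have hr1 : r ≤ 1 := hr.2.trans (max_le zero_le_one hζ)
  simp [hc r hr1]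

end Height

/-- The Cauchy-Riemann equation for the plane, as an identity at a point over `p` with last
coordinate `z`: here `P` and `Q` are the values of `d log |ζ|` and of the angular form. -/
theorem symplectizationJ_spiral {m : ℕ} {F Fθ Fσ : ℝ × ℝ → ℝ} {p : CircleSpace (m + 1)} {z : ℂ}
    (hp : p.2 = Pi.single (Fin.last m) z) (P Q : ℝ) :
    symplectizationJ (expMulForm (circleFun F) (lamZero (m + 1))) (reebField F Fθ Fσ)
      (stdJ (m + 1)) p
      (Complex.normSq z * Real.exp (circleFun F p) * P,
        (P * (Complex.normSq z ^ 2 * circleFun Fθ p / 2),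
          Pi.single (Fin.last m) (z * (P + Complex.I * Q + P * (Complex.normSq z * circleFun Fσ p -
            Complex.I / 2 * (Complex.normSq z * circleFun Fθ p)))))) =
      (-(Complex.normSq z * Real.exp (circleFun F p) * Q),
        (-Q * (Complex.normSq z ^ 2 * circleFun Fθ p / 2),
          Pi.single (Fin.last m) (z * (-Q + Complex.I * P - Q * (Complex.normSq z * circleFun Fσ p -
            Complex.I / 2 * (Complex.normSq z * circleFun Fθ p)))))) := by
  have hpl : p.2 (Fin.last m) = z := by rw [hp, Pi.single_eq_same]
  have hexp : Real.exp (circleFun F p) * Real.exp (-circleFun F p) = 1 := by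
    rw [← Real.exp_add, add_neg_cancel, Real.exp_zero]
  have hlam : ∀ v : CoverSpace (m + 1), expMulForm (circleFun F) (lamZero (m + 1)) p v =
      Real.exp (circleFun F p) *
        (v.1 + (z.re * (v.2 (Fin.last m)).im - z.im * (v.2 (Fin.last m)).re)) := fun v => by
    rw [expMulForm, smul_apply, lamZero_eq, hp, imPairing_single_left, smul_eq_mul]
  simp only [symplectizationJ, hlam, stdJ_apply, reebField, hp, imPairing_single_left, hpl]
  -- From here on the claim is a polynomial identity modulo `e e' = 1`.
  generalize Real.exp (circleFun F p) = e at *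
  generalize Real.exp (-circleFun F p) = e' at *
  generalize circleFun Fθ p = A
  generalize circleFun Fσ p = B
  obtain ⟨x, y⟩ := z
  refine Prod.ext ?_ (Prod.ext ?_ (funext fun i => ?_))
  · simp [Complex.normSq_apply, pow_two]
    ring
  · simp [Complex.normSq_apply, pow_two]
    linear_combination ((x * x + y * y) * P * (1 + (x * x + y * y) * B) -
      (x * x + y * y) ^ 2 * Q * A / 2) * hexp
  · rcases eq_or_ne i (Fin.last m) with rfl | hi
    · apply Complex.ext
      · simp [Complex.normSq_apply, pow_two]
        linear_combination ((x * x + y * y) * (P * (-(A / 2) * x + B * y) +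
          Q * (-(A / 2) * y - B * x))) * hexp
      · simp [Complex.normSq_apply, pow_two]
        linear_combination ((x * x + y * y) * (P * (-(A / 2) * y - B * x) -
          Q * (-(A / 2) * x + B * y))) * hexp
    · simp [hi]

/-! ### Cauchy-Riemann equation and energy of the planes -/

namespace SpiralTrajectory

variable {σ₀ : ℝ} {F Fθ Fσ : ℝ × ℝ → ℝ} {ϑ : ℝ → ℝ} {g : ℝ → ℂ} {σ : ℝ → ℝ}

theorem σ_pos (hT : SpiralTrajectory σ₀ Fθ Fσ ϑ g σ) (s : ℝ) : 0 < σ s := by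
  rw [hT.eq_σ]; exact Real.exp_pos _

theorem smooth_σ (hT : SpiralTrajectory σ₀ Fθ Fσ ϑ g σ) : ContDiff ℝ ∞ σ := by
  rw [show σ = fun s => Real.exp (2 * (s + (g s).re)) from funext hT.eq_σ]
  exact (contDiff_const.mul (contDiff_id.add (Complex.reCLM.contDiff.comp hT.smooth_g))).exp

theorem deriv_σ (hT : SpiralTrajectory σ₀ Fθ Fσ ϑ g σ) (s : ℝ) :
    HasDerivAt σ (2 * σ s * (1 + σ s * Fσ (ϑ s, σ s))) s := by
  have h1 := (Complex.reCLM.hasFDerivAt (x := g s)).comp_hasDerivAt s (hT.deriv_g s)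
  have h2 := (((hasDerivAt_id s).add h1).const_mul 2).exp
  refine (h2.congr_of_eventuallyEq (Eventually.of_forall fun r => ?_)).congr_deriv ?_
  · simp [hT.eq_σ]
  · rw [hT.eq_σ s]
    simp [-Complex.ofReal_exp]
    ring

theorem norm_sq_eq (hT : SpiralTrajectory σ₀ Fθ Fσ ϑ g σ) {ζ : ℂ} (hζ : ζ ≠ 0) :
    Complex.normSq (ζ * Complex.exp (g (Real.log ‖ζ‖))) = σ (Real.log ‖ζ‖) := by
  rw [hT.eq_σ, mul_add, Real.exp_add, exp_two_mul_log_norm hζ, map_mul,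
    Complex.normSq_eq_norm_sq, Complex.normSq_eq_norm_sq, Complex.norm_exp, ← Real.exp_nat_mul]
  norm_cast

/-- The function `λ(∂_t u)` of `s`, for a plane over a trajectory. -/
def action (F : ℝ × ℝ → ℝ) (ϑ σ : ℝ → ℝ) (s : ℝ) : ℝ := σ s * Real.exp (F (ϑ s, σ s))

theorem smooth_action (hF : SpiralProfile σ₀ F Fθ Fσ) (hT : SpiralTrajectory σ₀ Fθ Fσ ϑ g σ) :
    ContDiff ℝ ∞ (action F ϑ σ) :=
  hT.smooth_σ.mul (hF.smooth.comp (hT.smooth_ϑ.prodMk hT.smooth_σ)).exp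

theorem action_inner (hF : SpiralProfile σ₀ F Fθ Fσ) (hT : SpiralTrajectory σ₀ Fθ Fσ ϑ g σ) (s : ℝ)
    (hs : s ≤ 1) : action F ϑ σ s = Real.exp (2 * (g 0).re) * Real.exp (2 * s) := by
  have h := hT.small s hs
  rw [action, hF.inner _ _ h.le, Real.exp_zero, mul_one, hT.eq_σ, (hT.const s h).2, ← Real.exp_add]
  congr 1; ring

/-- Along a gradient line `log σ + F` grows at the rate of the squared gradient; hence the sum of
squares, and a nonnegative energy density. -/
theorem deriv_action (hF : SpiralProfile σ₀ F Fθ Fσ) (hT : SpiralTrajectory σ₀ Fθ Fσ ϑ g σ)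
    (s : ℝ) : HasDerivAt (action F ϑ σ) (action F ϑ σ s * (2 * (1 + σ s * Fσ (ϑ s, σ s)) ^ 2 +
      (σ s * Fθ (ϑ s, σ s)) ^ 2 / 2)) s := by
  have h := (hF.hasFDerivAt (ϑ s, σ s)).comp_hasDerivAt s ((hT.deriv_ϑ s).prodMk (hT.deriv_σ s))
  refine ((hT.deriv_σ s).mul h.exp).congr_deriv ?_
  simp [action]
  ring

theorem circleFun_spiralPlane (hT : SpiralTrajectory σ₀ Fθ Fσ ϑ g σ) {m : ℕ} {G : ℝ × ℝ → ℝ}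
    (hG : ∀ t σ, G (t + 2 * Real.pi, σ) = G (t, σ)) {ζ : ℂ} (hζ : ζ ≠ 0) :
    circleFun G (coverProj (spiralPlane m ϑ g ζ)) = G (ϑ (Real.log ‖ζ‖), σ (Real.log ‖ζ‖)) := by
  rw [circleFun_coverProj hG]
  simp only [spiralPlane, Pi.single_eq_same, hT.norm_sq_eq hζ]

theorem contDiff_spiralPlane (hT : SpiralTrajectory σ₀ Fθ Fσ ϑ g σ) (m : ℕ) :
    ContDiff ℝ ∞ (spiralPlane m ϑ g) := by
  have hc := fun s hs => hT.const s (hT.small s hs)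
  have hz : ContDiff ℝ ∞ fun ζ : ℂ => ζ * Complex.exp (g (Real.log ‖ζ‖)) :=
    contDiff_id.mul (contDiff_radial hT.smooth_g fun s hs => (hc s hs).2).cexp
  exact (contDiff_radial hT.smooth_ϑ fun s hs => (hc s hs).1).prodMk
    ((ContinuousLinearMap.single ℝ (fun _ : Fin (m + 1) => ℂ) (Fin.last m)).contDiff.comp hz)

theorem fderiv_spiralPlane (hT : SpiralTrajectory σ₀ Fθ Fσ ϑ g σ) (m : ℕ) {ζ : ℂ} (hζ : ζ ≠ 0)
    (w : ℂ) {s : ℝ} (hs : s = Real.log ‖ζ‖) :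
    fderiv ℝ (spiralPlane m ϑ g) ζ w = (dlog ζ w * (σ s ^ 2 * Fθ (ϑ s, σ s) / 2),
      Pi.single (Fin.last m) (ζ * Complex.exp (g s) * (dlog ζ w + Complex.I * dang ζ w +
        dlog ζ w * (σ s * Fσ (ϑ s, σ s) - Complex.I / 2 * (σ s * Fθ (ϑ s, σ s)))))) := by
  subst hs
  have h1 := hasFDerivAt_radial hζ (hT.deriv_ϑ _)
  have h2 := (hasFDerivAt_id ζ).mul (hasFDerivAt_radial hζ (hT.deriv_g _)).cexp
  have h3 := (ContinuousLinearMap.single ℝ (fun _ : Fin (m + 1) => ℂ)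
    (Fin.last m)).hasFDerivAt.comp ζ h2
  have h4 := (h1.prodMk h3).fderiv
  change fderiv ℝ (spiralPlane m ϑ g) ζ = _ at h4
  rw [h4]
  refine Prod.ext (by simp) ?_
  simp only [ContinuousLinearMap.prod_apply, ContinuousLinearMap.comp_apply,
    ContinuousLinearMap.single_apply]
  congr 1
  simp
  linear_combination (-Complex.exp (g (Real.log ‖ζ‖))) * mul_dlog_add_dang hζ w

theorem fderiv_spiralPlane_zero (hT : SpiralTrajectory σ₀ Fθ Fσ ϑ g σ) (m : ℕ) (w : ℂ) :
    fderiv ℝ (spiralPlane m ϑ g) 0 w = (0, Pi.single (Fin.last m) (w * Complex.exp (g 0))) := by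
  have h1 := (hasFDerivAt_id (𝕜 := ℝ) (0 : ℂ)).mul_const (Complex.exp (g 0))
  have h2 := (hasFDerivAt_const (ϑ 0) (0 : ℂ)).prodMk ((ContinuousLinearMap.single ℝ
    (fun _ : Fin (m + 1) => ℂ) (Fin.last m)).hasFDerivAt.comp (0 : ℂ) h1)
  have h3 := h2.congr_of_eventuallyEq (f₁ := spiralPlane m ϑ g) (by
    filter_upwards [log_norm_le_one_eventually] with ζ hζ
    obtain ⟨e1, e2⟩ := hT.const _ (hT.small _ hζ)
    rw [spiralPlane, e1, e2]
    rfl)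
  rw [h3.fderiv]
  simp [mul_comm]

/-- The height function of the plane. -/
def height (F : ℝ × ℝ → ℝ) (ϑ : ℝ → ℝ) (g : ℝ → ℂ) (σ : ℝ → ℝ) : ℂ → ℝ :=
  spiralHeight (Real.exp (2 * (g 0).re)) (action F ϑ σ)

theorem cauchyRiemann (hF : SpiralProfile σ₀ F Fθ Fσ) (hT : SpiralTrajectory σ₀ Fθ Fσ ϑ g σ)
    (m : ℕ) (ζ w : ℂ) :
    (fderiv ℝ (height F ϑ g σ) ζ (Complex.I * w),
        fderiv ℝ (spiralPlane m ϑ g) ζ (Complex.I * w)) =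
      symplectizationJ (expMulForm (circleFun F) (lamZero (m + 1))) (reebField F Fθ Fσ)
        (stdJ (m + 1)) (coverProj (spiralPlane m ϑ g ζ))
        (fderiv ℝ (height F ϑ g σ) ζ w, fderiv ℝ (spiralPlane m ϑ g) ζ w) := by
  rcases eq_or_ne ζ 0 with rfl | hζ
  · have ha : fderiv ℝ (height F ϑ g σ) 0 = 0 :=
      (hasFDerivAt_spiralHeight_zero (action_inner hF hT)).fderiv
    have hu : (coverProj (spiralPlane m ϑ g 0)).2 = 0 := by simp [spiralPlane, coverProj]
    have hl : ∀ b, expMulForm (circleFun F) (lamZero (m + 1)) (coverProj (spiralPlane m ϑ g 0))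
        (0, b) = 0 := fun b => by
      rw [expMulForm, smul_apply, lamZero_eq, hu]
      simp [imPairing]
    simp only [ha, hT.fderiv_spiralPlane_zero, symplectizationJ, hl, stdJ_apply, hu]
    refine Prod.ext (by simp) (Prod.ext (by simp [imPairing]) (funext fun i => ?_))
    rcases eq_or_ne i (Fin.last m) with rfl | hi
    · simp [mul_assoc]
    · simp [hi]
  · have ha : fderiv ℝ (height F ϑ g σ) ζ = _ :=
      (hasFDerivAt_spiralHeight (smooth_action hF hT).continuous hζ).fderiv
    have h := symplectizationJ_spiral (m := m) (F := F) (Fθ := Fθ) (Fσ := Fσ)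
      (p := coverProj (spiralPlane m ϑ g ζ)) (z := ζ * Complex.exp (g (Real.log ‖ζ‖))) rfl
      (dlog ζ w) (dang ζ w)
    rw [hT.norm_sq_eq hζ, hT.circleFun_spiralPlane hF.periodic hζ,
      hT.circleFun_spiralPlane hF.periodic_θ hζ, hT.circleFun_spiralPlane hF.periodic_σ hζ] at h
    rw [ha, hT.fderiv_spiralPlane m hζ w rfl, hT.fderiv_spiralPlane m hζ (Complex.I * w) rfl,
      dlog_I_mul, dang_I_mul]
    refine Eq.trans ?_ h.symm
    simp only [smul_apply, dlog_I_mul, action, smul_eq_mul]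
    push_cast
    refine Prod.ext (by simp) (Prod.ext rfl ?_)
    simp only
    congr 1
    ring

theorem isPseudoholomorphicPlane (hF : SpiralProfile σ₀ F Fθ Fσ)
    (hT : SpiralTrajectory σ₀ Fθ Fσ ϑ g σ) (m : ℕ) :
    IsPseudoholomorphicPlane (expMulForm (circleFun F) (lamZero (m + 1))) (stdJ (m + 1))
      (height F ϑ g σ) (fun ζ => coverProj (spiralPlane m ϑ g ζ)) (spiralPlane m ϑ g) where
  smooth := contDiff_spiralHeight (smooth_action hF hT) (action_inner hF hT)
  lift := ⟨hT.contDiff_spiralPlane m, fun _ => rfl⟩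
  holomorphic := ⟨_, hF.isReebField m, cauchyRiemann hF hT m⟩

/-- The pulled-back form is `φ(A) H dt`, with `H` the action and `A` the height in terms of `s`. Its
coefficient is nondecreasing and lies between `0` and `C`, so each integral is at most `2πC`. -/
theorem hoferEnergy_lt_top (hF : SpiralProfile σ₀ F Fθ Fσ)
    (hT : SpiralTrajectory σ₀ Fθ Fσ ϑ g σ) (m : ℕ) :
    hoferEnergy (expMulForm (circleFun F) (lamZero (m + 1))) (height F ϑ g σ)
      (spiralPlane m ϑ g) < ⊤ := by
  obtain ⟨C, hC⟩ := hF.bounded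
  have hHs := smooth_action hF hT
  have hH0 : ∀ s, 0 ≤ action F ϑ σ s := fun s => mul_nonneg (hT.σ_pos s).le (Real.exp_pos _).le
  have hHC : ∀ s, action F ϑ σ s ≤ C := fun s => hC _ _ (hT.σ_pos s).le
  refine lt_of_le_of_lt (b := ENNReal.ofReal C * ENNReal.ofReal (2 * Real.pi)) ?_
    (ENNReal.mul_lt_top ENNReal.ofReal_lt_top ENNReal.ofReal_lt_top)
  refine iSup₂_le fun φ hφ => ?_
  set A := radialHeight (Real.exp (2 * (g 0).re)) (action F ϑ σ) with hA
  have hAd : ∀ s, HasDerivAt A (action F ϑ σ s) s := hasDerivAt_radialHeight hHs.continuous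
  have hφd : ∀ x, HasDerivAt φ (deriv φ x) x := fun x =>
    (hφ.smooth.differentiable (by simp) x).hasDerivAt
  have hG : ∀ s, HasDerivAt (fun s => φ (A s) * action F ϑ σ s) _ s := fun s =>
    ((hφd _).comp s (hAd s)).mul (deriv_action hF hT s)
  have hpull : ∀ ζ : ℂ, ζ ≠ 0 → (φ (height F ϑ g σ ζ)) •
      (expMulForm (circleFun F) (lamZero (m + 1)) (coverProj (spiralPlane m ϑ g ζ))).comp
        (fderiv ℝ (spiralPlane m ϑ g) ζ) =
      (φ (A (Real.log ‖ζ‖)) * action F ϑ σ (Real.log ‖ζ‖)) • dang ζ := by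
    intro ζ hζ
    refine ContinuousLinearMap.ext fun w => ?_
    -- The `∂_a` component of the Cauchy-Riemann equation reads `u^*λ = -da ∘ i`, which gives `u^*λ`
    -- from the height without further computation.
    have h1 := congrArg Prod.fst (cauchyRiemann hF hT m ζ w)
    have ha : fderiv ℝ (height F ϑ g σ) ζ = _ :=
      (hasFDerivAt_spiralHeight hHs.continuous hζ).fderiv
    rw [ha, smul_apply, dlog_I_mul] at h1
    simp only [symplectizationJ, smul_eq_mul] at h1
    rw [smul_apply, smul_apply, ContinuousLinearMap.comp_apply, height, spiralHeight_eq hζ]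
    simp only [smul_eq_mul]
    linear_combination φ (A (Real.log ‖ζ‖)) * h1
  have hae : ∀ᵐ ζ : ℂ, ζ ≠ 0 := by simp [ae_iff, measure_singleton]
  refine (lintegral_congr_ae ?_).trans_le (lintegral_radial_le hG ?_ ?_ ?_ ?_)
  · filter_upwards [hae] with ζ hζ
    rw [extDerivOne_radial hζ (hG _)]
    filter_upwards [isOpen_ne.mem_nhds hζ] with y hy using hpull y hy
  · have hAc : Continuous A := continuous_iff_continuousAt.2 fun s => (hAd s).continuousAt
    have h1 : Continuous (deriv φ) := hφ.smooth.continuous_deriv (by simp)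
    have h2 := hφ.smooth.continuous
    have h3 := hHs.continuous
    have h4 := hT.smooth_σ.continuous
    have h5 : Continuous fun s => Fθ (ϑ s, σ s) :=
      hF.smooth_θ.continuous.comp (hT.smooth_ϑ.continuous.prodMk h4)
    have h6 : Continuous fun s => Fσ (ϑ s, σ s) :=
      hF.smooth_σ.continuous.comp (hT.smooth_ϑ.continuous.prodMk h4)
    exact (((h1.comp hAc).mul h3).mul h3).add ((h2.comp hAc).mul (h3.mul
      ((continuous_const.mul ((continuous_const.add (h4.mul h6)).pow 2)).add
        (((h4.mul h5).pow 2).div_const 2))))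
  · intro s
    have h1 := hφ.deriv_nonneg (A s)
    have h2 := (hφ.mem_Icc (A s)).1
    have h3 := hH0 s
    simp only [Function.comp_apply]
    positivity
  · exact fun s => mul_nonneg (hφ.mem_Icc _).1 (hH0 s)
  · exact fun s => (mul_le_of_le_one_left (hH0 s) (hφ.mem_Icc _).2).trans (hHC s)

end SpiralTrajectory

/-! ### Limit sets -/

/-- The loop `t ↦ (θ, 0, e^{2πit} ρ)`, in the universal cover. -/
def circleLoop (m : ℕ) (θ : ℝ) (ρ : ℂ) (t : ℝ) : CoverSpace (m + 1) :=
  (θ, Pi.single (Fin.last m) (Complex.exp (2 * Real.pi * Complex.I * t) * ρ))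

theorem hasDerivAt_exp_loop (a : ℂ) (t : ℝ) :
    HasDerivAt (fun t : ℝ => Complex.exp (2 * Real.pi * Complex.I * t) * a)
      (Complex.exp (2 * Real.pi * Complex.I * t) * (2 * Real.pi * Complex.I * a)) t := by
  have h := ((Complex.ofRealCLM.hasDerivAt (x := t)).const_mul (2 * Real.pi * Complex.I)).cexp
  refine (h.mul_const a).congr_deriv ?_
  simp
  ring

theorem hasDerivAt_circleLoop (m : ℕ) (θ : ℝ) (ρ : ℂ) (t : ℝ) :
    HasDerivAt (circleLoop m θ ρ) (circleLoop m 0 (2 * Real.pi * Complex.I * ρ) t) t :=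
  (hasDerivAt_const t θ).prodMk ((ContinuousLinearMap.single ℝ (fun _ : Fin (m + 1) => ℂ)
    (Fin.last m)).hasFDerivAt.comp_hasDerivAt t (hasDerivAt_exp_loop ρ t))

theorem contDiff_circleLoop (m : ℕ) (θ : ℝ) (ρ : ℂ) : ContDiff ℝ ∞ (circleLoop m θ ρ) :=
  contDiff_const.prodMk ((ContinuousLinearMap.single ℝ (fun _ : Fin (m + 1) => ℂ)
    (Fin.last m)).contDiff.comp
      ((contDiff_const.mul Complex.ofRealCLM.contDiff).cexp.mul contDiff_const))

theorem iteratedDeriv_circleLoop (m : ℕ) (θ : ℝ) (ρ : ℂ) (j : ℕ) :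
    iteratedDeriv j (circleLoop m θ ρ) =
      circleLoop m (if j = 0 then θ else 0) ((2 * Real.pi * Complex.I) ^ j * ρ) := by
  induction j with
  | zero => simp
  | succ j ih =>
    rw [iteratedDeriv_succ, ih]
    funext t
    rw [(hasDerivAt_circleLoop m _ _ t).deriv]
    simp [pow_succ']
    ring_nf

theorem norm_exp_loop (t : ℝ) : ‖Complex.exp (2 * Real.pi * Complex.I * t)‖ = 1 := by
  rw [show 2 * Real.pi * Complex.I * t = ((2 * Real.pi * t : ℝ) : ℂ) * Complex.I by push_cast; ring,
    Complex.norm_exp_ofReal_mul_I]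

theorem dist_circleLoop (m : ℕ) (θ : ℝ) (ρ ρ' : ℂ) (t : ℝ) :
    dist (circleLoop m θ ρ t) (circleLoop m θ ρ' t) = dist ρ ρ' := by
  rw [dist_eq_norm, dist_eq_norm, circleLoop, circleLoop, Prod.mk_sub_mk, sub_self,
    ← Pi.single_sub, Prod.norm_mk, Pi.norm_single, ← mul_sub, norm_mul, norm_exp_loop]
  simp

theorem tendstoLoops_circleLoop {m : ℕ} {c : ℕ → ℝ → CircleSpace (m + 1)} {θ : ℝ} {ρ : ℕ → ℂ}
    {ρ' : ℂ} (hc : ∀ k t, c k t = coverProj (circleLoop m θ (ρ k) t))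
    (hρ : Tendsto ρ atTop (𝓝 ρ')) :
    TendstoLoops c fun t => coverProj (circleLoop m θ ρ' t) := by
  refine ⟨fun k => circleLoop m θ (ρ k), circleLoop m θ ρ',
    fun k => ⟨contDiff_circleLoop m θ _, fun t => (hc k t).symm⟩,
    ⟨contDiff_circleLoop m θ _, fun _ => rfl⟩, fun j => ?_⟩
  rw [Metric.tendstoUniformlyOn_iff]
  intro ε hε
  have h := (hρ.const_mul ((2 * Real.pi * Complex.I) ^ j)).eventually (Metric.ball_mem_nhds _ hε)
  filter_upwards [h] with k hk t _
  rw [iteratedDeriv_circleLoop, iteratedDeriv_circleLoop, dist_circleLoop, dist_comm]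
  exact hk

/-- At `σ = σ₀` both `F_θ` and `1 + σ F_σ` vanish, and the Reeb field is `e^{-F} σ₀⁻¹ √-1 z`. One
turn takes time `2π σ₀ C`, where `C` is the constant value of `e^F` there. -/
theorem SpiralProfile.isPeriodicReebOrbit {σ₀ : ℝ} {F Fθ Fσ : ℝ × ℝ → ℝ}
    (hF : SpiralProfile σ₀ F Fθ Fσ) (m : ℕ) (θ : ℝ) {ρ : ℂ} (hρ : Complex.normSq ρ = σ₀) :
    IsPeriodicReebOrbit (expMulForm (circleFun F) (lamZero (m + 1)))
      fun t => coverProj (circleLoop m θ ρ t) := by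
  obtain ⟨C, hC, hFC⟩ := hF.exp_outer
  have h0 := hF.pos
  refine ⟨fun t => ?_, _, circleLoop m θ ρ, hF.isReebField m,
    ⟨contDiff_circleLoop m θ ρ, fun _ => rfl⟩, 2 * Real.pi * σ₀ * C, by positivity, fun t => ?_⟩
  · have : Complex.exp (2 * Real.pi * Complex.I * (t + 1 : ℝ)) =
        Complex.exp (2 * Real.pi * Complex.I * t) := by
      rw [← Complex.exp_periodic (2 * Real.pi * Complex.I * t)]; congr 1; push_cast; ring
    simp only [circleLoop, this]
  · rw [(hasDerivAt_circleLoop m θ ρ t).deriv]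
    set z := Complex.exp (2 * Real.pi * Complex.I * t) * ρ with hz
    have hzn : Complex.normSq z = σ₀ := by
      rw [hz, map_mul, Complex.normSq_eq_norm_sq, norm_exp_loop, hρ]; simp
    have hlast : (coverProj (circleLoop m θ ρ t)).2 (Fin.last m) = z := by
      simp [coverProj, circleLoop, hz]
    have hp : ∀ {G : ℝ × ℝ → ℝ}, (∀ t σ, G (t + 2 * Real.pi, σ) = G (t, σ)) →
        circleFun G (coverProj (circleLoop m θ ρ t)) = G (θ, σ₀) := fun hG => by
      rw [circleFun_coverProj hG]
      change _ = _ at hlast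
      rw [show (circleLoop m θ ρ t).2 (Fin.last m) = z from hlast, hzn]
      rfl
    have hσ := hF.outer_σ θ σ₀ le_rfl
    rw [reebField, hp hF.periodic, hp hF.periodic_θ, hp hF.periodic_σ, hlast, hzn, hσ,
      hF.outer_θ θ σ₀ le_rfl, Real.exp_neg, hFC]
    have hσ' : Fσ (θ, σ₀) = -σ₀⁻¹ := by field_simp; linarith
    rw [hσ', circleLoop]
    refine Prod.ext (by simp) (funext fun i => ?_)
    rcases eq_or_ne i (Fin.last m) with rfl | hi
    · have : (σ₀ : ℂ) ≠ 0 := by exact_mod_cast h0.ne'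
      have : (C : ℂ) ≠ 0 := by exact_mod_cast hC.ne'
      simp [hz]
      field_simp
    · simp [hi]

namespace SpiralTrajectory

variable {σ₀ : ℝ} {F Fθ Fσ : ℝ × ℝ → ℝ} {ϑ : ℝ → ℝ} {g : ℝ → ℂ} {σ : ℝ → ℝ}

theorem planeLoop_spiralPlane (m : ℕ) (ϑ : ℝ → ℝ) (g : ℝ → ℂ) (S t : ℝ) :
    planeLoop (fun ζ => coverProj (spiralPlane m ϑ g ζ)) S t =
      coverProj (circleLoop m (ϑ (2 * Real.pi * S))
        (Complex.exp ((2 * Real.pi * S : ℝ) + g (2 * Real.pi * S))) t) := by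
  have hn : ‖Complex.exp (2 * Real.pi * (S + t * Complex.I))‖ = Real.exp (2 * Real.pi * S) := by
    rw [Complex.norm_exp]; simp
  rw [planeLoop, spiralPlane, hn, Real.log_exp, circleLoop, ← Complex.exp_add, ← Complex.exp_add]
  congr 4
  push_cast
  ring

theorem normSq_exp (hT : SpiralTrajectory σ₀ Fθ Fσ ϑ g σ) (s : ℝ) :
    Complex.normSq (Complex.exp (s + g s)) = σ s := by
  rw [hT.eq_σ, Complex.normSq_eq_norm_sq, Complex.norm_exp, ← Real.exp_nat_mul]
  simp

theorem exists_angle (hT : SpiralTrajectory σ₀ Fθ Fσ ϑ g σ) (θ : ℝ) (n : ℕ) :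
    ∃ r : ℝ, (n : ℝ) ≤ r ∧ ((ϑ r : ℝ) : AddCircle (2 * Real.pi)) = (θ : ℝ) := by
  obtain ⟨N, hN⟩ := exists_nat_gt ((ϑ n - θ) / (2 * Real.pi))
  rw [div_lt_iff₀ (by positivity)] at hN
  obtain ⟨b, hb1, hb2⟩ := ((tendsto_atTop.1 hT.tendsto_ϑ (θ + N * (2 * Real.pi))).and
    (eventually_ge_atTop (n : ℝ))).exists
  obtain ⟨r, hr, hre⟩ := intermediate_value_Icc hb2 hT.smooth_ϑ.continuous.continuousOn
    (show θ + N * (2 * Real.pi) ∈ Icc (ϑ n) (ϑ b) from ⟨by linarith, hb1⟩)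
  refine ⟨r, hr.1, ?_⟩
  rw [hre, ← sub_eq_zero, ← AddCircle.coe_sub, AddCircle.coe_eq_zero_iff]
  exact ⟨N, by simp⟩

/-- All loops of the plane are round circles `circleLoop`, so only angle and complex radius need to
converge. Since `σ → σ₀`, limits lie on the torus; conversely `exists_angle` fixes any angle exactly
along a sequence, and compactness handles the radius. -/
theorem limitSet_eq {r₀ : ℝ} (hr₀ : 0 < r₀) (hF : SpiralProfile (r₀ ^ 2) F Fθ Fσ)
    (hT : SpiralTrajectory (r₀ ^ 2) Fθ Fσ ϑ g σ) (m : ℕ) :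
    limitSet (expMulForm (circleFun F) (lamZero (m + 1)))
      (fun ζ => coverProj (spiralPlane m ϑ g ζ)) =
      {p | ∃ (θ : AddCircle (2 * Real.pi)) (w : ℂ), ‖w‖ = r₀ ∧ p = lastFactorPoint θ w} := by
  have hnorm : ∀ s, ‖Complex.exp (s + g s)‖ = Real.sqrt (σ s) := fun s => by
    rw [← hT.normSq_exp, Complex.normSq_eq_norm_sq, Real.sqrt_sq (norm_nonneg _)]
  have hlim : Tendsto (fun s : ℝ => ‖Complex.exp (s + g s)‖) atTop (𝓝 r₀) := by
    simp only [hnorm]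
    have := hT.tendsto_σ.sqrt
    rwa [Real.sqrt_sq hr₀.le] at this
  ext p
  constructor
  · rintro ⟨γ, ⟨⟨hper, -⟩, S, hS, c', γ', hc', hγ', hconv⟩, t, rfl⟩
    obtain ⟨t, ht, e⟩ := hper.exists_mem_Ico₀ one_pos t
    rw [e]
    -- Pointwise convergence, from the derivative of order zero, suffices for this inclusion.
    have h1 : Tendsto (fun k => c' k t) atTop (𝓝 (γ' t)) := by
      simpa using (hconv 0).tendsto_at ⟨ht.1, ht.2.le⟩
    have h2 : ∀ k, (c' k t).2 = Pi.single (Fin.last m)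
        (Complex.exp (2 * Real.pi * Complex.I * t) *
          Complex.exp ((2 * Real.pi * S k : ℝ) + g (2 * Real.pi * S k))) := fun k => by
      have := congrArg Prod.snd ((hc' k).lift t)
      beta_reduce at this
      rwa [planeLoop_spiralPlane] at this
    have h3 : ∀ i, Tendsto (fun k => (c' k t).2 i) atTop (𝓝 ((γ' t).2 i)) := fun i =>
      (((continuous_apply i).comp continuous_snd).tendsto _).comp h1
    have hlast : ‖(γ' t).2 (Fin.last m)‖ = r₀ := by
      refine tendsto_nhds_unique (h3 (Fin.last m)).norm ?_
      simp only [h2, Pi.single_eq_same, norm_mul, norm_exp_loop, one_mul]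
      exact hlim.comp (hS.const_mul_atTop (by positivity))
    refine ⟨(γ t).1, (γ' t).2 (Fin.last m), hlast, ?_⟩
    rw [← hγ'.lift t]
    refine Prod.ext rfl (funext fun i => ?_)
    rcases eq_or_ne i (Fin.last m) with rfl | hi
    · simp [lastFactorPoint, coverProj]
    · have h4 : (γ' t).2 i = 0 := by
        refine tendsto_nhds_unique (h3 i) ?_
        simp only [h2, Pi.single_eq_of_ne hi]
        exact tendsto_const_nhds
      simp [lastFactorPoint, coverProj, hi, h4]
  · rintro ⟨θ, w, hw, rfl⟩
    obtain ⟨θ, rfl⟩ := QuotientAddGroup.mk_surjective θ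
    choose r hr hθ using hT.exists_angle θ
    have hrt : Tendsto r atTop atTop := tendsto_atTop_mono hr tendsto_natCast_atTop_atTop
    have hbdd : ∀ n, Complex.exp (r n + g (r n)) ∈ Metric.closedBall (0 : ℂ) r₀ := fun n => by
      rw [mem_closedBall_zero_iff, hnorm]
      exact (Real.sqrt_le_sqrt (hT.lt _).le).trans_eq (Real.sqrt_sq hr₀.le)
    -- The phase of the complex radius need not converge, hence the subsequence. The limit phase is
    -- irrelevant, as the whole circle lies in the orbit.
    obtain ⟨ρ, -, φ, hφ, hφρ⟩ := (isCompact_closedBall (0 : ℂ) r₀).tendsto_subseq hbdd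
    have hρ : ‖ρ‖ = r₀ :=
      tendsto_nhds_unique hφρ.norm (hlim.comp (hrt.comp hφ.tendsto_atTop))
    have hρ2 : Complex.normSq ρ = r₀ ^ 2 := by rw [Complex.normSq_eq_norm_sq, hρ]
    refine ⟨fun t => coverProj (circleLoop m θ ρ t), ⟨hF.isPeriodicReebOrbit m θ hρ2,
      fun k => r (φ k) / (2 * Real.pi), ?_, ?_⟩, ?_⟩
    · exact (hrt.comp hφ.tendsto_atTop).atTop_div_const (by positivity)
    · refine tendstoLoops_circleLoop (fun k t => ?_) hφρ
      have h2 : 2 * Real.pi * (r (φ k) / (2 * Real.pi)) = r (φ k) := by field_simp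
      simp only [planeLoop_spiralPlane, h2]
      exact Prod.ext (hθ (φ k)) rfl
    · have hρ0 : ρ ≠ 0 := by rw [← norm_pos_iff, hρ]; exact hr₀
      have hq : ‖w / ρ‖ = 1 := by rw [norm_div, hw, hρ, div_self hr₀.ne']
      refine ⟨Complex.arg (w / ρ) / (2 * Real.pi), ?_⟩
      have h1 : Complex.exp (2 * Real.pi * Complex.I *
          (Complex.arg (w / ρ) / (2 * Real.pi) : ℝ)) = w / ρ := by
        have h2 := Complex.norm_mul_exp_arg_mul_I (w / ρ)
        rw [hq, Complex.ofReal_one, one_mul] at h2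
        have hpi : (Real.pi : ℂ) ≠ 0 := by exact_mod_cast Real.pi_ne_zero
        refine Eq.trans ?_ h2
        congr 1
        push_cast
        field_simp
      simp only [circleLoop, h1, div_mul_cancel₀ _ hρ0]
      rfl

end SpiralTrajectory

end

/-! ### Planes through every point of the disc -/

theorem theorem5p2 (m : ℕ) (r₀ : ℝ) (hr₀ : 0 < r₀) :
    ∃ (F : CircleSpace (m + 1) → ℝ)
      (J : CircleSpace (m + 1) → CoverSpace (m + 1) →L[ℝ] CoverSpace (m + 1)),
      SmoothOnCircleSpace F ∧ IsCompatibleJ (lamZero (m + 1)) J ∧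
      ∀ (θ₀ : AddCircle (2 * Real.pi)) (z : ℂ), ‖z‖ < r₀ →
        ∃ (a : ℂ → ℝ) (u : ℂ → CircleSpace (m + 1)),
          IsFiniteEnergyPlane (expMulForm F (lamZero (m + 1))) J a u ∧
          lastFactorPoint θ₀ z ∈ range u ∧
          limitSet (expMulForm F (lamZero (m + 1))) u =
            {p | ∃ (θ : AddCircle (2 * Real.pi)) (w : ℂ), ‖w‖ = r₀ ∧ p = lastFactorPoint θ w} := by
  have h0 : 0 < r₀ ^ 2 := by positivity
  obtain ⟨F, Fθ, Fσ, hF⟩ := exists_spiralProfile h0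
  refine ⟨circleFun F, stdJ (m + 1), smooth_circleFun hF.periodic hF.smooth,
    isCompatibleJ_stdJ (m + 1), fun θ₀ z hz => ?_⟩
  obtain ⟨t₀, rfl⟩ := QuotientAddGroup.mk_surjective θ₀
  suffices h : ∃ (ϑ : ℝ → ℝ) (g : ℝ → ℂ) (σ : ℝ → ℝ), SpiralTrajectory (r₀ ^ 2) Fθ Fσ ϑ g σ ∧
      ∃ ζ, spiralPlane m ϑ g ζ = (t₀, Pi.single (Fin.last m) z) by
    obtain ⟨ϑ, g, σ, hT, ζ, hζ⟩ := h
    refine ⟨SpiralTrajectory.height F ϑ g σ, fun ζ => coverProj (spiralPlane m ϑ g ζ),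
      ⟨_, hT.isPseudoholomorphicPlane hF m, hT.hoferEnergy_lt_top hF m⟩, ⟨ζ, ?_⟩,
      hT.limitSet_eq hr₀ hF m⟩
    simp only [hζ]
    rfl
  rcases eq_or_ne z 0 with rfl | hz0
  -- The logarithm of `z = 0` is unavailable. Start instead at `σ = r₀² / 4 < σ₀ / 3`, in the region
  -- where `ϑ` is constant, so that the plane passes through `(t₀, 0)` at `ζ = 0`.
  · have he : Real.exp (2 * ((Real.log (r₀ ^ 2 / 4) / 2 : ℝ) : ℂ).re) = r₀ ^ 2 / 4 := by
      rw [Complex.ofReal_re, mul_div_cancel₀ _ two_ne_zero, Real.exp_log (by positivity)]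
    obtain ⟨ϑ, g, σ, s₀, hT, hϑ, hg⟩ := hF.exists_trajectory t₀
      ((Real.log (r₀ ^ 2 / 4) / 2 : ℝ) : ℂ) (by rw [he]; linarith)
    have hσ : σ s₀ < r₀ ^ 2 / 3 := by
      rw [← hg] at he
      have h1 := hT.eq_σ s₀
      rw [show s₀ + (g s₀).re = ((s₀ : ℂ) + g s₀).re by simp, he] at h1
      rw [h1]; linarith
    refine ⟨ϑ, g, σ, hT, 0, ?_⟩
    rw [spiralPlane, norm_zero, Real.log_zero, zero_mul, ← (hT.const s₀ hσ).1, hϑ]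
  · have he : Real.exp (2 * (Complex.log z).re) = ‖z‖ ^ 2 := by
      rw [Complex.log_re, exp_two_mul_log_norm hz0]
    obtain ⟨ϑ, g, σ, s₀, hT, hϑ, hg⟩ := hF.exists_trajectory t₀ (Complex.log z)
      (by rw [he]; gcongr)
    -- At the positive real point `e^{s₀}` the last coordinate is `e^{s₀ + g(s₀)} = e^{log z} = z`.
    refine ⟨ϑ, g, σ, hT, Complex.exp s₀, ?_⟩
    rw [spiralPlane, Complex.norm_exp, Complex.ofReal_re, Real.log_exp, hϑ, ← Complex.exp_add, hg,
      Complex.exp_log hz0]
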